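/- Write $L^p_{\rm loc}(\mathbb R_+)$ for the functions on $\mathbb R_+=[0,\infty)$ that are in $L^p(0,T)$ for every $T<\infty$ (identified when equal almost everywhere), $(K*f)(t)=\int_0^t K(t-s)f(s)\,ds$, and $\Delta_h k(t)=k(t+h)$. Consider the following two conditions on a scalar kernel $k$. (A) $k\in L^2_{\rm loc}(\mathbb R_+,\mathbb R)$ and there is $\gamma\in(0,2]$ such that, as $h\downarrow0$, $\int_0^h k(t)^2dt=O(h^\gamma)$ and $\int_0^T(k(t+h)-k(t))^2dt=O(h^\gamma)$ for every $T<\infty$. (B) On $(0,\infty)$, $k$ is nonnegative, not identically zero, non-increasing and continuous; and $k$ has a resolvent of the first kind $L$, that is, a measure on $\mathbb R_+$ of locally bounded variation with $\int_{[0,t]}k(t-s)\,L(ds)=1$ for all $t>0$, which is nonnegative and non-increasing in the sense that $s\mapsto L([s,s+t])$ is non-increasing on $\mathbb R_+$ for every $t\ge0$. Theorem. Let $K\in L^2_{\rm loc}(\mathbb R_+,\mathbb R^{d\times d})$ be diagonal with scalar kernels $K_1,\dots,K_d$ on the diagonal. Assume that each $K_i$ satisfies (A) and that the shifted kernel $\Delta_hK_i$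 satisfies (B) for every $i$ and every $h\in[0,1]$. Let $u,v\in\mathbb R^d$, $F\in L^1_{\rm loc}(\mathbb R_+,\mathbb R^d)$ and $G\in L^2_{\rm loc}(\mathbb R_+,\mathbb R^{d\times d})$ be such that $u_i\ge0$, $v_i\ge0$ and $F_i\ge0$ for all $i$, and $G_{ij}\ge0$ for all $i\ne j$ (the inequalities for $F$ and $G$ holding almost everywhere). Then the linear Volterra equation $$\chi=Ku+v+K*(F+G\chi)$$ has a unique solution $\chi\in L^2_{\rm loc}(\mathbb R_+,\mathbb R^d)$ (the equation and uniqueness being understood almost everywhere), and this solution satisfies $\chi_i\ge0$ almost everywhere for $i=1,\dots,d$. -/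

import Mathlib

open MeasureTheory Set Filter Topology Asymptotics

/-! Functions on `ℝ₊ = [0, ∞)` are represented by functions on `ℝ`; only their values on `[0, ∞)`
matter below. -/

/-- Lebesgue measure on `ℝ₊ = [0, ∞)`. -/
noncomputable def volPos : Measure ℝ := (volume : Measure ℝ).restrict (Ici 0)

/-- `f ∈ L^p_loc(ℝ₊, E)`: `f` is in `L^p` on `[0, T]` for every `T < ∞`. -/
def MemLpLoc {E : Type*} [NormedAddCommGroup E] (p : ENNReal) (f : ℝ → E) : Prop :=
  ∀ T : ℝ, MemLp f p ((volume : Measure ℝ).restrict (Icc 0 T))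

/-- `M ∈ L^p_loc(ℝ₊, ℝ^{d×d})`; membership is tested on the entries, which is the same as using any
norm on the (finite-dimensional) space of matrices. -/
def MatrixMemLpLoc {d : ℕ} (p : ENNReal) (M : ℝ → Matrix (Fin d) (Fin d) ℝ) : Prop :=
  ∀ i j, MemLpLoc p (fun t => M t i j)

/-- The shift `Δ_h k`. -/
def kernelShift (h : ℝ) (k : ℝ → ℝ) : ℝ → ℝ := fun t => k (t + h)

/-- The regularity condition on scalar kernels: `k ∈ L²_loc(ℝ₊, ℝ)` and there is `γ ∈ (0, 2]` with
`∫_0^h k(t)² dt = O(h^γ)` and `∫_0^T (k(t+h) - k(t))² dt = O(h^γ)` as `h ↓ 0`, for every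
`T < ∞`. -/
def GammaCondition (k : ℝ → ℝ) : Prop :=
  MemLpLoc 2 k ∧
    ∃ γ : ℝ, 0 < γ ∧ γ ≤ 2 ∧
      ((fun h : ℝ => ∫ t in (0 : ℝ)..h, k t ^ 2) =O[𝓝[>] 0] fun h : ℝ => h ^ γ) ∧
      ∀ T : ℝ, 0 ≤ T →
        ((fun h : ℝ => ∫ t in (0 : ℝ)..T, (k (t + h) - k t) ^ 2) =O[𝓝[>] 0] fun h : ℝ => h ^ γ)

/-- `L` is a nonnegative resolvent of the first kind of the scalar kernel `k`: a locally finite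
(nonnegative) measure on `ℝ₊` with `(k * L)(t) = ∫_{[0,t]} k(t-s) L(ds) = 1` for `t > 0`. -/
structure IsNonnegFirstKindResolvent (k : ℝ → ℝ) (L : Measure ℝ) : Prop where
  locallyFinite : IsLocallyFiniteMeasure L
  support : L (Iio 0) = 0
  integrable : ∀ t : ℝ, 0 < t → IntegrableOn (fun s => k (t - s)) (Icc 0 t) L
  conv_eq_one : ∀ t : ℝ, 0 < t → ∫ s in Icc 0 t, k (t - s) ∂L = 1

/-- The monotonicity condition on scalar kernels: on `(0, ∞)`, `k` is nonnegative, not identically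
zero, non-increasing and continuous, and its resolvent of the first kind `L` is nonnegative and
non-increasing, in that `s ↦ L([s, s+t])` is non-increasing on `ℝ₊` for all `t ≥ 0`.
(A resolvent of the first kind is unique when it exists.) -/
structure OrthantCondition (k : ℝ → ℝ) : Prop where
  nonneg : ∀ t : ℝ, 0 < t → 0 ≤ k t
  not_zero : ∃ t : ℝ, 0 < t ∧ k t ≠ 0
  antitone : AntitoneOn k (Ioi 0)
  continuous : ContinuousOn k (Ioi 0)
  resolvent : ∃ L : Measure ℝ, IsNonnegFirstKindResolvent k L ∧
    ∀ t : ℝ, 0 ≤ t → AntitoneOn (fun s : ℝ => L (Icc s (s + t))) (Ici 0)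

/-- `χ` is an `L²_loc(ℝ₊, ℝ^d)` solution of the linear Volterra equation
`χ = K u + v + K * (F + G χ)`, where `(K * f)(t) = ∫_0^t K(t-s) f(s) ds`. The equation is
between elements of `L²_loc`, that is, almost everywhere, and the convolution is required to be
well-defined almost everywhere. -/
structure IsLinearVolterraSolution {d : ℕ} (K : ℝ → Matrix (Fin d) (Fin d) ℝ) (u v : Fin d → ℝ)
    (F : ℝ → Fin d → ℝ) (G : ℝ → Matrix (Fin d) (Fin d) ℝ) (χ : ℝ → Fin d → ℝ) : Prop where
  memL2 : MemLpLoc 2 χ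
  integrable : ∀ᵐ t ∂volPos, IntervalIntegrable
    (fun s => (K (t - s)).mulVec (F s + (G s).mulVec (χ s))) volume 0 t
  equation : ∀ᵐ t ∂volPos, χ t = (K t).mulVec u + v +
    ∫ s in (0 : ℝ)..t, (K (t - s)).mulVec (F s + (G s).mulVec (χ s))

/-! Well-posedness is an `L²` contraction argument. On `[0, T]`, multiplication by `G ∈ L²` maps
`L²` to `L¹`, and convolution with `K ∈ L²` maps `L¹` back to `L²`. The weight `e^{-ct}` passes
through a convolution, and for large `c` it makes the `L²` norm of the kernel as small as desired.
This gives an `L²` Gronwall inequality (`exists_volterra_gronwall`). Applied to partial sums it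
yields convergence of the Neumann series (`exists_solution`); applied to differences it yields
stability in the kernel and in `v` (`exists_stability`), hence uniqueness.

Positivity is first proved for bounded kernels and strictly positive `v`, where the solution has a
continuous version. If that version leaves the open orthant, some component `x` vanishes at a first
time `τ > 0`. Convolving its equation with the resolvent `L` gives `(x * L)(t) = u + v L([0,t]) +
∫_0^t f`, and `f ≥ -|G_ii| x` before `τ`, since the other components are still positive. This
identity at `τ` is compared with the one at a maximum point `σ` of `x` on a short interval `[τ-δ,
τ]`. The atom `L({0})`, which is positive because the kernel is bounded, contributes `L({0}) x(σ)`
at `σ` and nothing at `τ`. Since `L` is non-increasing, the history before `σ` weighs no more at `τ`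
than at `σ`. What remains is at most `x(σ) (L((0,δ]) + ∫_{τ-δ}^τ |G_ii|)`, which for small `δ`
cannot make up for the lost atom (`IsNonnegFirstKindResolvent.ne_zero_of_pos`).

For general kernels, replace `K_i` by `Δ_h K_i` and `v_i` by `v_i + h`. By monotonicity the shifted
kernels are bounded, are dominated by `K_i`, and converge to it in `L²(0,T)`, so stability carries
nonnegativity to the limit. -/

/-! ### Convolution estimates and an `L²` Gronwall inequality -/

theorem lintegral_mul_sq_le {α : Type*} [MeasurableSpace α] (μ : Measure α) {f g : α → ENNReal}
    (hf : AEMeasurable f μ) (hg : AEMeasurable g μ) :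
    (∫⁻ x, f x * g x ∂μ) ^ 2 ≤ (∫⁻ x, f x ^ 2 ∂μ) * ∫⁻ x, g x ^ 2 ∂μ := by
  have h := ENNReal.lintegral_mul_le_Lp_mul_Lq μ Real.HolderConjugate.two_two hf hg
  have h2 := pow_le_pow_left₀ (zero_le) h 2
  refine h2.trans (le_of_eq ?_)
  rw [mul_pow]
  simp only [← ENNReal.rpow_natCast, ← ENNReal.rpow_mul]
  norm_num

/-- Young's inequality `L² * L¹ ⊆ L²`: Cauchy–Schwarz for the measure `f(s) ds` gives `(a * f)² ≤
(a² * f) ‖f‖₁`, and Tonelli integrates the right-hand side. -/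
theorem lintegral_convolution_sq_le {a f : ℝ → ENNReal} (ha : Measurable a) (hf : Measurable f) :
    ∫⁻ t, (∫⁻ s, a (t - s) * f s) ^ 2 ≤ (∫⁻ s, a s ^ 2) * (∫⁻ s, f s) ^ 2 := by
  have h1 : ∀ t, (∫⁻ s, a (t - s) * f s) ^ 2 ≤ (∫⁻ s, f s * a (t - s) ^ 2) * ∫⁻ s, f s := by
    intro t
    have hat : Measurable fun s => a (t - s) := ha.comp (measurable_const.sub measurable_id)
    have h := lintegral_mul_sq_le (volume.withDensity f) (f := fun s => a (t - s))
      (g := fun _ => 1) hat.aemeasurable measurable_const.aemeasurable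
    rw [lintegral_withDensity_eq_lintegral_mul _ hf (by fun_prop),
      lintegral_withDensity_eq_lintegral_mul _ hf (by fun_prop),
      lintegral_withDensity_eq_lintegral_mul _ hf (by fun_prop)] at h
    simpa [mul_comm] using h
  calc ∫⁻ t, (∫⁻ s, a (t - s) * f s) ^ 2
      ≤ ∫⁻ t, (∫⁻ s, f s * a (t - s) ^ 2) * ∫⁻ s, f s := lintegral_mono h1
    _ = (∫⁻ t, ∫⁻ s, f s * a (t - s) ^ 2) * ∫⁻ s, f s := by
        rw [lintegral_mul_const]
        exact Measurable.lintegral_prod_right' (f := fun p : ℝ × ℝ => f p.2 * a (p.1 - p.2) ^ 2)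
          (by fun_prop)
    _ = (∫⁻ s, f s * ∫⁻ t, a t ^ 2) * ∫⁻ s, f s := by
        congr 1
        rw [lintegral_lintegral_swap (by fun_prop)]
        refine lintegral_congr fun s => ?_
        rw [lintegral_const_mul _ (by fun_prop)]
        congr 1
        exact lintegral_sub_right_eq_self (fun t => a t ^ 2) s
    _ = (∫⁻ s, a s ^ 2) * (∫⁻ s, f s) ^ 2 := by
        rw [lintegral_mul_const _ hf]; ring

/-- Causality: for `t ≤ T` only `s` and `t - s` in `[0, T]` contribute, so both functions may be
truncated to `[0, T]`. -/
theorem setLIntegral_convolution_sq_le {a f : ℝ → ENNReal} (ha : Measurable a) (hf : Measurable f)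
    (ha0 : ∀ t < 0, a t = 0) (hf0 : ∀ t < 0, f t = 0) (T : ℝ) :
    ∫⁻ t in Icc 0 T, (∫⁻ s, a (t - s) * f s) ^ 2
      ≤ (∫⁻ s in Icc 0 T, a s ^ 2) * (∫⁻ s in Icc 0 T, f s) ^ 2 := by
  have h := lintegral_convolution_sq_le (ha.indicator (measurableSet_Icc (a := 0) (b := T)))
    (hf.indicator (measurableSet_Icc (a := 0) (b := T)))
  have e1 : ∫⁻ s, (Icc 0 T).indicator a s ^ 2 = ∫⁻ s in Icc 0 T, a s ^ 2 := by
    rw [← lintegral_indicator measurableSet_Icc]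
    refine lintegral_congr fun s => ?_
    by_cases hs : s ∈ Icc 0 T <;> simp [hs]
  rw [e1, lintegral_indicator measurableSet_Icc] at h
  refine le_trans ?_ h
  rw [← lintegral_indicator measurableSet_Icc]
  refine lintegral_mono fun t => ?_
  by_cases ht : t ∈ Icc 0 T
  · rw [indicator_of_mem ht]
    refine pow_le_pow_left₀ zero_le (lintegral_mono fun s => ?_) 2
    · by_cases hs : s ∈ Icc 0 T
      · by_cases hts : s ≤ t
        · rw [indicator_of_mem (show t - s ∈ Icc 0 T from
            ⟨by linarith, by linarith [hs.1, ht.2]⟩), indicator_of_mem hs]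
        · rw [ha0 (t - s) (by linarith)]; simp
      · rcases lt_or_ge s 0 with h0 | h0
        · rw [hf0 s h0]; simp
        · have : T < s := by by_contra hh; exact hs ⟨h0, not_lt.1 hh⟩
          rw [ha0 (t - s) (by linarith [ht.2])]; simp
  · simp [ht]

/-- The exponential weight `e^{-λ t}`. -/
noncomputable def expWeight (c t : ℝ) : ENNReal := ENNReal.ofReal (Real.exp (-(c * t)))

theorem measurable_expWeight (c : ℝ) : Measurable (expWeight c) := by
  unfold expWeight; fun_prop

/-- This multiplicativity lets the weight be distributed over the two factors of a convolution. -/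
theorem expWeight_sub_mul (c t s : ℝ) :
    expWeight c (t - s) * expWeight c s = expWeight c t := by
  unfold expWeight
  rw [← ENNReal.ofReal_mul (Real.exp_pos _).le, ← Real.exp_add]
  congr 2; ring

/-- Dominated convergence as `c → ∞`: the weight tends to zero at every `s > 0`, and `a²` is an
integrable majorant. -/
theorem exists_setLIntegral_expWeight_le {a : ℝ → ENNReal} (ha : Measurable a) (T : ℝ)
    (hfin : ∫⁻ s in Icc 0 T, a s ^ 2 ≠ ⊤) {ε : ENNReal} (hε : 0 < ε) :
    ∃ c : ℝ, 0 ≤ c ∧ ∫⁻ s in Icc 0 T, (expWeight c s * a s) ^ 2 ≤ ε := by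
  have hlim : Tendsto (fun n : ℕ => ∫⁻ s in Icc 0 T, (expWeight n s * a s) ^ 2) atTop
      (𝓝 (∫⁻ s in Icc (0 : ℝ) T, 0)) := by
    refine tendsto_lintegral_of_dominated_convergence (fun s => a s ^ 2) (fun n => ?_) (fun n => ?_)
      hfin ?_
    · have := measurable_expWeight n
      fun_prop
    · filter_upwards [ae_restrict_mem measurableSet_Icc] with s hs
      gcongr
      refine mul_le_of_le_one_left (zero_le) ?_
      unfold expWeight
      rw [ENNReal.ofReal_le_one, Real.exp_le_one_iff]
      have := mul_nonneg (Nat.cast_nonneg (α := ℝ) n) hs.1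
      linarith
    · have hne : ∀ᵐ s ∂(volume.restrict (Icc (0 : ℝ) T)), s ≠ 0 :=
        ae_restrict_of_ae (by simp [ae_iff])
      filter_upwards [ae_restrict_mem measurableSet_Icc, hne,
        ae_lt_top (ha.pow_const 2) hfin] with s hs hs0 hfs
      have hs1 : 0 < s := lt_of_le_of_ne hs.1 (Ne.symm hs0)
      have hw : Tendsto (fun n : ℕ => expWeight n s) atTop (𝓝 0) := by
        unfold expWeight
        rw [← ENNReal.ofReal_zero]
        refine ENNReal.tendsto_ofReal ?_
        refine Real.tendsto_exp_atBot.comp ?_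
        refine tendsto_neg_atTop_atBot.comp ?_
        exact tendsto_natCast_atTop_atTop.atTop_mul_const hs1
      have hw2 : Tendsto (fun n : ℕ => expWeight n s ^ 2 * a s ^ 2) atTop (𝓝 (0 ^ 2 * a s ^ 2)) :=
        ENNReal.Tendsto.mul_const (ENNReal.Tendsto.pow hw) (Or.inr hfs.ne)
      simpa [mul_pow] using hw2
  simp only [lintegral_zero] at hlim
  obtain ⟨n, hn⟩ := ((tendsto_order.1 hlim).2 ε hε).exists
  exact ⟨n, by positivity, hn.le⟩

theorem ENNReal.add_sq_le (x y : ENNReal) : (x + y) ^ 2 ≤ 2 * (x ^ 2 + y ^ 2) := by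
  have := ENNReal.rpow_add_le_mul_rpow_add_rpow x y (p := 2) (by norm_num)
  norm_num at this
  exact this

theorem setLIntegral_volterra_sq_le {a b φ : ℝ → ENNReal} (ha : Measurable a) (hb : Measurable b)
    (hφ : Measurable φ) (ha0 : ∀ t < 0, a t = 0) (hb0 : ∀ t < 0, b t = 0) (T : ℝ) :
    ∫⁻ t in Icc 0 T, (∫⁻ s, a (t - s) * (b s * φ s)) ^ 2
      ≤ (∫⁻ s in Icc 0 T, a s ^ 2) *
        ((∫⁻ s in Icc 0 T, b s ^ 2) * ∫⁻ s in Icc 0 T, φ s ^ 2) := by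
  refine (setLIntegral_convolution_sq_le ha (hb.mul hφ) ha0 ?_ T).trans ?_
  · intro t ht; simp [hb0 t ht]
  · gcongr
    exact lintegral_mul_sq_le _ hb.aemeasurable hφ.aemeasurable

/-- An `L²` Gronwall inequality for Volterra convolution operators. -/
theorem exists_volterra_gronwall {a b : ℝ → ENNReal} (ha : Measurable a) (hb : Measurable b)
    (ha0 : ∀ t < 0, a t = 0) (hb0 : ∀ t < 0, b t = 0) (T : ℝ)
    (haT : ∫⁻ s in Icc 0 T, a s ^ 2 ≠ ⊤) (hbT : ∫⁻ s in Icc 0 T, b s ^ 2 ≠ ⊤) :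
    ∃ C : ENNReal, C ≠ ⊤ ∧ ∀ φ ψ : ℝ → ENNReal, Measurable φ → Measurable ψ →
      ∫⁻ s in Icc 0 T, φ s ^ 2 ≠ ⊤ →
      (∀ᵐ t ∂(volume.restrict (Icc 0 T)), φ t ≤ ψ t + ∫⁻ s, a (t - s) * (b s * φ s)) →
      ∫⁻ s in Icc 0 T, φ s ^ 2 ≤ C * ∫⁻ s in Icc 0 T, ψ s ^ 2 := by
  set B := ∫⁻ s in Icc 0 T, b s ^ 2 with hB
  -- With this `ε` the weighted operator has squared norm at most `ε B ≤ 1/4`; `B + 1` replaces `B`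
  -- so that the inverse cancels even when `B = 0`.
  obtain ⟨c, hc0, hc⟩ := exists_setLIntegral_expWeight_le ha T haT
    (ε := 4⁻¹ * (B + 1)⁻¹) (by
      refine ENNReal.mul_pos (by simp) ?_
      simp [hbT])
  have hw := measurable_expWeight c
  -- The factor `e^{2cT}` removes the squared weight on `[0, T]`. The constant does not depend on
  -- `φ` or `ψ`, so the bound is uniform over partial sums and over dominated kernels.
  refine ⟨expWeight (-(2 * c)) T * 4, by unfold expWeight; finiteness, ?_⟩
  intro φ ψ hφ hψ hφT hle
  have hw1 : ∀ t ∈ Icc 0 T, expWeight c t ≤ 1 := by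
    intro t ht
    unfold expWeight
    rw [ENNReal.ofReal_le_one, Real.exp_le_one_iff]
    have := mul_nonneg hc0 ht.1
    linarith
  have hwφ : ∫⁻ t in Icc 0 T, (expWeight c t * φ t) ^ 2 ≠ ⊤ := by
    refine ne_top_of_le_ne_top hφT (setLIntegral_mono' measurableSet_Icc fun t ht => ?_)
    gcongr
    exact mul_le_of_le_one_left (zero_le) (hw1 t ht)
  have hconv : ∫⁻ t in Icc 0 T, (expWeight c t * ∫⁻ s, a (t - s) * (b s * φ s)) ^ 2
      ≤ 4⁻¹ * ∫⁻ t in Icc 0 T, (expWeight c t * φ t) ^ 2 := by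
    have h := setLIntegral_volterra_sq_le (hw.mul ha) hb (hw.mul hφ)
      (fun t ht => by simp [ha0 t ht]) hb0 T
    have e : ∀ t, expWeight c t * ∫⁻ s, a (t - s) * (b s * φ s)
        = ∫⁻ s, (expWeight c * a) (t - s) * (b s * (expWeight c * φ) s) := by
      intro t
      rw [← lintegral_const_mul _ (by fun_prop)]
      refine lintegral_congr fun s => ?_
      simp only [Pi.mul_apply]
      rw [← expWeight_sub_mul c t s]; ring
    simp_rw [e]
    refine h.trans ?_
    rw [← mul_assoc]
    gcongr ?_ * _
    calc _ ≤ 4⁻¹ * (B + 1)⁻¹ * (B + 1) := by gcongr; exacts [hc, le_self_add]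
      _ = 4⁻¹ := by rw [mul_assoc, ENNReal.inv_mul_cancel (by simp) (by finiteness), mul_one]
  have hmain : ∫⁻ t in Icc 0 T, (expWeight c t * φ t) ^ 2
      ≤ 4 * ∫⁻ t in Icc 0 T, ψ t ^ 2 := by
    set X := ∫⁻ t in Icc 0 T, (expWeight c t * φ t) ^ 2
    set Y := ∫⁻ t in Icc 0 T, ψ t ^ 2
    -- This reads `X ≤ 2Y + X/2`; finiteness of `X` then allows absorption, giving `X ≤ 4Y`.
    have h1 : X ≤ 2 * (Y + 4⁻¹ * X) := by
      calc X ≤ ∫⁻ t in Icc 0 T, 2 * (ψ t ^ 2 +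
              (expWeight c t * ∫⁻ s, a (t - s) * (b s * φ s)) ^ 2) := by
            refine lintegral_mono_ae ?_
            filter_upwards [hle, ae_restrict_mem measurableSet_Icc] with t ht htT
            refine le_trans ?_ (ENNReal.add_sq_le _ _)
            gcongr
            calc expWeight c t * φ t ≤ expWeight c t * (ψ t + ∫⁻ s, a (t - s) * (b s * φ s)) := by
                  gcongr
              _ ≤ _ := by
                  rw [mul_add]
                  gcongr
                  exact mul_le_of_le_one_left (zero_le) (hw1 t htT)
        _ = 2 * (Y + ∫⁻ t in Icc 0 T,
              (expWeight c t * ∫⁻ s, a (t - s) * (b s * φ s)) ^ 2) := by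
            rw [lintegral_const_mul', lintegral_add_left (by fun_prop)]
            simp
        _ ≤ _ := by gcongr
    clear_value X Y
    rcases eq_or_ne Y ⊤ with hY | hY
    · rw [hY]; simp
    · lift Y to NNReal using hY
      lift X to NNReal using hwφ
      have h4 : (4⁻¹ : ENNReal) = ((4⁻¹ : NNReal) : ENNReal) := by simp
      rw [h4] at h1
      norm_cast at h1 ⊢
      have h1' : (X : ℝ) ≤ 2 * (Y + 4⁻¹ * X) := by exact_mod_cast h1
      have : (X : ℝ) ≤ 4 * Y := by linarith
      exact_mod_cast this
  calc ∫⁻ t in Icc 0 T, φ t ^ 2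
      ≤ ∫⁻ t in Icc 0 T, expWeight (-(2 * c)) T * (expWeight c t * φ t) ^ 2 := by
        refine setLIntegral_mono' measurableSet_Icc fun t ht => ?_
        rw [mul_pow, ← mul_assoc]
        refine le_mul_of_one_le_left (zero_le) ?_
        unfold expWeight
        rw [← ENNReal.ofReal_pow (Real.exp_pos _).le, ← ENNReal.ofReal_mul (Real.exp_pos _).le,
          ← Real.exp_nat_mul, ← Real.exp_add, ENNReal.one_le_ofReal, Real.one_le_exp_iff]
        have := mul_le_mul_of_nonneg_left ht.2 hc0
        push_cast
        linarith
    _ = expWeight (-(2 * c)) T * ∫⁻ t in Icc 0 T, (expWeight c t * φ t) ^ 2 := by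
        rw [lintegral_const_mul _ (by fun_prop)]
    _ ≤ expWeight (-(2 * c)) T * (4 * ∫⁻ t in Icc 0 T, ψ t ^ 2) := by gcongr
    _ = _ := by ring

/-! ### Almost-everywhere statements on the half-line and square-integrable sums -/

theorem Ici_zero_eq_iUnion_Icc : Ici (0 : ℝ) = ⋃ n : ℕ, Icc (0 : ℝ) n := by
  ext t
  simp only [mem_Ici, mem_iUnion, mem_Icc]
  refine ⟨fun ht => ?_, fun ⟨n, hn⟩ => hn.1⟩
  obtain ⟨n, hn⟩ := exists_nat_ge t
  exact ⟨n, ht, hn⟩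

theorem ae_volPos_of_forall_Icc {p : ℝ → Prop}
    (h : ∀ T : ℝ, ∀ᵐ t ∂(volume.restrict (Icc 0 T)), p t) : ∀ᵐ t ∂volPos, p t := by
  rw [volPos, Ici_zero_eq_iUnion_Icc, ae_restrict_iUnion_iff]
  exact fun n => h n

theorem ae_Icc_of_ae_volPos {p : ℝ → Prop} (h : ∀ᵐ t ∂volPos, p t) (T : ℝ) :
    ∀ᵐ t ∂(volume.restrict (Icc 0 T)), p t :=
  ae_restrict_of_ae_restrict_of_subset Icc_subset_Ici_self h

theorem lintegral_add_sq_ne_top {α : Type*} [MeasurableSpace α] {μ : Measure α}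
    {f g : α → ENNReal} (hf : Measurable f) (hf2 : ∫⁻ x, f x ^ 2 ∂μ ≠ ⊤)
    (hg2 : ∫⁻ x, g x ^ 2 ∂μ ≠ ⊤) : ∫⁻ x, (f x + g x) ^ 2 ∂μ ≠ ⊤ := by
  refine ne_top_of_le_ne_top (b := 2 * (∫⁻ x, f x ^ 2 ∂μ + ∫⁻ x, g x ^ 2 ∂μ)) (by finiteness) ?_
  rw [← lintegral_add_left (by fun_prop), ← lintegral_const_mul' _ _ (by simp)]
  exact lintegral_mono fun x => ENNReal.add_sq_le _ _

theorem lintegral_finset_sum_sq_ne_top {α ι : Type*} [MeasurableSpace α] {μ : Measure α}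
    (s : Finset ι) {f : ι → α → ENNReal} (hf : ∀ i ∈ s, Measurable (f i))
    (hf2 : ∀ i ∈ s, ∫⁻ x, f i x ^ 2 ∂μ ≠ ⊤) : ∫⁻ x, (∑ i ∈ s, f i x) ^ 2 ∂μ ≠ ⊤ := by
  classical
  induction s using Finset.induction_on with
  | empty => simp
  | insert i s hi ih =>
    simp_rw [Finset.sum_insert hi]
    exact lintegral_add_sq_ne_top (hf i (by simp)) (hf2 i (by simp))
      (ih (fun j hj => hf j (by simp [hj])) (fun j hj => hf2 j (by simp [hj])))

/-! ### Vector-valued Volterra operators and the Neumann series -/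

section

variable {d : ℕ}

/-- The sum of the absolute values of the entries of a matrix. -/
noncomputable def matrixEnorm (M : Matrix (Fin d) (Fin d) ℝ) : ENNReal := ∑ i, ∑ j, ‖M i j‖ₑ

theorem enorm_pi_le {x : Fin d → ℝ} {c : ENNReal} (h : ∀ i, ‖x i‖ₑ ≤ c) : ‖x‖ₑ ≤ c := by
  rcases eq_or_ne c ⊤ with rfl | hc
  · simp
  · lift c to NNReal using hc
    simp only [enorm_eq_nnnorm, ENNReal.coe_le_coe] at h ⊢
    exact pi_nnnorm_le_iff.2 h

theorem enorm_apply_le (x : Fin d → ℝ) (i : Fin d) : ‖x i‖ₑ ≤ ‖x‖ₑ := by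
  simp only [enorm_eq_nnnorm, ENNReal.coe_le_coe]
  exact nnnorm_le_pi_nnnorm x i

theorem enorm_mulVec_le (M : Matrix (Fin d) (Fin d) ℝ) (x : Fin d → ℝ) :
    ‖M.mulVec x‖ₑ ≤ matrixEnorm M * ‖x‖ₑ := by
  refine enorm_pi_le fun i => ?_
  calc ‖M.mulVec x i‖ₑ ≤ ∑ j, ‖M i j * x j‖ₑ := by
        rw [Matrix.mulVec, dotProduct]
        exact enorm_sum_le _ _
    _ ≤ ∑ j, ‖M i j‖ₑ * ‖x‖ₑ := by
        gcongr with j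
        rw [enorm_mul]
        gcongr
        exact enorm_apply_le x j
    _ = (∑ j, ‖M i j‖ₑ) * ‖x‖ₑ := by rw [Finset.sum_mul]
    _ ≤ _ := by
        gcongr
        exact Finset.single_le_sum (f := fun i => ∑ j, ‖M i j‖ₑ) (fun _ _ => zero_le)
          (Finset.mem_univ i)

theorem enorm_pi_mul_le (x y : Fin d → ℝ) : ‖x * y‖ₑ ≤ ‖x‖ₑ * ‖y‖ₑ := by
  refine enorm_pi_le fun i => ?_
  rw [Pi.mul_apply, enorm_mul]
  gcongr <;> exact enorm_apply_le _ _

theorem Measurable.mulVec {α : Type*} [MeasurableSpace α] {M : α → Matrix (Fin d) (Fin d) ℝ}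
    {x : α → Fin d → ℝ} (hM : ∀ i j, Measurable fun t => M t i j) (hx : Measurable x) :
    Measurable fun t => (M t).mulVec (x t) := by
  rw [measurable_pi_iff]
  intro i
  simp only [Matrix.mulVec, dotProduct]
  exact Finset.measurable_sum _ fun j _ => (hM i j).mul ((measurable_pi_apply j).comp hx)

theorem measurable_matrixEnorm {α : Type*} [MeasurableSpace α]
    {M : α → Matrix (Fin d) (Fin d) ℝ} (hM : ∀ i j, Measurable fun t => M t i j) :
    Measurable fun t => matrixEnorm (M t) := by
  unfold matrixEnorm
  exact Finset.measurable_sum _ fun i _ => Finset.measurable_sum _ fun j _ => (hM i j).enorm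

/-- The data of a Volterra operator with diagonal convolution kernel `D` and multiplier `G`:
measurable functions in `L²_loc(ℝ₊)` extended by zero to the negative half-line. -/
structure VolterraData (D : ℝ → Fin d → ℝ) (G : ℝ → Matrix (Fin d) (Fin d) ℝ) : Prop where
  kernel_meas : Measurable D
  kernel_neg : ∀ t < 0, D t = 0
  kernel_sq : ∀ T : ℝ, ∫⁻ s in Icc 0 T, ‖D s‖ₑ ^ 2 ≠ ⊤
  mult_meas : ∀ i j, Measurable fun t => G t i j
  mult_neg : ∀ t < 0, G t = 0
  mult_sq : ∀ T : ℝ, ∫⁻ s in Icc 0 T, matrixEnorm (G s) ^ 2 ≠ ⊤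

/-- The operator `φ ↦ D * (G φ)`. -/
noncomputable def volterraOp (D : ℝ → Fin d → ℝ) (G : ℝ → Matrix (Fin d) (Fin d) ℝ)
    (φ : ℝ → Fin d → ℝ) (t : ℝ) : Fin d → ℝ :=
  ∫ s, D (t - s) * (G s).mulVec (φ s)

namespace VolterraData

variable {D : ℝ → Fin d → ℝ} {G : ℝ → Matrix (Fin d) (Fin d) ℝ}

theorem matrixEnorm_neg (h : VolterraData D G) (t : ℝ) (ht : t < 0) : matrixEnorm (G t) = 0 := by
  simp [matrixEnorm, h.mult_neg t ht]

theorem enorm_kernel_neg (h : VolterraData D G) (t : ℝ) (ht : t < 0) : ‖D t‖ₑ = 0 := by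
  simp [h.kernel_neg t ht]

theorem measurable_integrand (h : VolterraData D G) {φ : ℝ → Fin d → ℝ} (hφ : Measurable φ) :
    Measurable fun p : ℝ × ℝ => D (p.1 - p.2) * (G p.2).mulVec (φ p.2) :=
  (h.kernel_meas.comp (measurable_fst.sub measurable_snd)).mul
    ((Measurable.mulVec h.mult_meas hφ).comp measurable_snd)

theorem measurable_op (h : VolterraData D G) {φ : ℝ → Fin d → ℝ} (hφ : Measurable φ) :
    Measurable (volterraOp D G φ) :=
  ((h.measurable_integrand hφ).stronglyMeasurable.integral_prod_right).measurable

theorem enorm_integrand_le (t s : ℝ) (φ : ℝ → Fin d → ℝ) :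
    ‖D (t - s) * (G s).mulVec (φ s)‖ₑ ≤ ‖D (t - s)‖ₑ * (matrixEnorm (G s) * ‖φ s‖ₑ) := by
  refine (enorm_pi_mul_le _ _).trans ?_
  gcongr
  exact enorm_mulVec_le _ _

theorem enorm_op_le (t : ℝ) (φ : ℝ → Fin d → ℝ) :
    ‖volterraOp D G φ t‖ₑ ≤ ∫⁻ s, ‖D (t - s)‖ₑ * (matrixEnorm (G s) * ‖φ s‖ₑ) :=
  (enorm_integral_le_lintegral_enorm _).trans
    (lintegral_mono fun s => enorm_integrand_le t s φ)

theorem measurable_majorant (h : VolterraData D G) {S : ℝ → ENNReal} (hS : Measurable S) :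
    Measurable fun t => ∫⁻ s, ‖D (t - s)‖ₑ * (matrixEnorm (G s) * S s) := by
  have h1 := h.kernel_meas
  have h2 : Measurable fun p : ℝ × ℝ => matrixEnorm (G p.2) :=
    (measurable_matrixEnorm h.mult_meas).comp measurable_snd
  refine Measurable.lintegral_prod_right'
    (f := fun p : ℝ × ℝ => ‖D (p.1 - p.2)‖ₑ * (matrixEnorm (G p.2) * S p.2)) ?_
  fun_prop

theorem majorant_sq_ne_top (h : VolterraData D G) {S : ℝ → ENNReal} (hS : Measurable S) (T : ℝ)
    (hS2 : ∫⁻ s in Icc 0 T, S s ^ 2 ≠ ⊤) :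
    ∫⁻ t in Icc 0 T, (∫⁻ s, ‖D (t - s)‖ₑ * (matrixEnorm (G s) * S s)) ^ 2 ≠ ⊤ :=
  ne_top_of_le_ne_top
    (ENNReal.mul_ne_top (h.kernel_sq T) (ENNReal.mul_ne_top (h.mult_sq T) hS2))
    (setLIntegral_volterra_sq_le h.kernel_meas.enorm (measurable_matrixEnorm h.mult_meas) hS
      h.enorm_kernel_neg h.matrixEnorm_neg T)

/-- The square of the majorant is integrable on every `[0, T]`. Its finiteness at almost every `t`
justifies exchanging sum and integral in the Neumann series. -/
theorem ae_majorant_lt_top (h : VolterraData D G) {S : ℝ → ENNReal} (hS : Measurable S)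
    (hS2 : ∀ T : ℝ, ∫⁻ s in Icc 0 T, S s ^ 2 ≠ ⊤) :
    ∀ᵐ t ∂volPos, ∫⁻ s, ‖D (t - s)‖ₑ * (matrixEnorm (G s) * S s) < ⊤ := by
  refine ae_volPos_of_forall_Icc fun T => ?_
  filter_upwards [ae_lt_top ((h.measurable_majorant hS).pow_const 2)
    (h.majorant_sq_ne_top hS T (hS2 T))] with t ht
  exact (ENNReal.pow_lt_top_iff.1 ht).resolve_right (by norm_num)

theorem exists_gronwall (h : VolterraData D G) (T : ℝ) :
    ∃ C : ENNReal, C ≠ ⊤ ∧ ∀ φ ψ : ℝ → ENNReal, Measurable φ → Measurable ψ →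
      ∫⁻ s in Icc 0 T, φ s ^ 2 ≠ ⊤ →
      (∀ᵐ t ∂(volume.restrict (Icc 0 T)),
        φ t ≤ ψ t + ∫⁻ s, ‖D (t - s)‖ₑ * (matrixEnorm (G s) * φ s)) →
      ∫⁻ s in Icc 0 T, φ s ^ 2 ≤ C * ∫⁻ s in Icc 0 T, ψ s ^ 2 :=
  exists_volterra_gronwall h.kernel_meas.enorm (measurable_matrixEnorm h.mult_meas)
    h.enorm_kernel_neg h.matrixEnorm_neg T (h.kernel_sq T) (h.mult_sq T)

/-- Existence of `L²_loc` solutions of `χ = g + D * (G χ)`, by the Neumann series. -/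
theorem exists_solution (h : VolterraData D G) {g : ℝ → Fin d → ℝ} (hg : Measurable g)
    (hg2 : ∀ T : ℝ, ∫⁻ s in Icc 0 T, ‖g s‖ₑ ^ 2 ≠ ⊤) :
    ∃ χ : ℝ → Fin d → ℝ, Measurable χ ∧ (∀ T : ℝ, ∫⁻ s in Icc 0 T, ‖χ s‖ₑ ^ 2 ≠ ⊤) ∧
      ∀ᵐ t ∂volPos, χ t = g t + volterraOp D G χ t := by
  set φ : ℕ → ℝ → Fin d → ℝ := fun n => (volterraOp D G)^[n] g with hφdef
  have hφs : ∀ n, φ (n + 1) = volterraOp D G (φ n) := fun n => by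
    simp only [hφdef, Function.iterate_succ_apply']
  have hφm : ∀ n, Measurable (φ n) := by
    intro n
    induction n with
    | zero => exact hg
    | succ n ih => rw [hφs]; exact h.measurable_op ih
  have hφ2 : ∀ n (T : ℝ), ∫⁻ s in Icc 0 T, ‖φ n s‖ₑ ^ 2 ≠ ⊤ := by
    intro n
    induction n with
    | zero => exact hg2
    | succ n ih =>
      intro T
      refine ne_top_of_le_ne_top (h.majorant_sq_ne_top (hφm n).enorm T (ih T))
        (lintegral_mono fun t => ?_)
      rw [hφs]
      gcongr
      exact enorm_op_le t _
  set S : ℝ → ENNReal := fun t => ∑' n, ‖φ n t‖ₑ with hSdef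
  have hSm : Measurable S := Measurable.tsum fun n => (hφm n).enorm
  have hpart : ∀ n t, ∑ k ∈ Finset.range (n + 1), ‖φ k t‖ₑ ≤ ‖g t‖ₑ +
      ∫⁻ s, ‖D (t - s)‖ₑ * (matrixEnorm (G s) * ∑ k ∈ Finset.range n, ‖φ k s‖ₑ) := by
    intro n t
    rw [Finset.sum_range_succ', add_comm]
    simp_rw [Finset.mul_sum]
    rw [lintegral_finsetSum]
    · gcongr with k
      · exact le_rfl
      · rw [hφs]; exact enorm_op_le t _
    · intro k _
      have h1 := h.kernel_meas
      have h2 := measurable_matrixEnorm h.mult_meas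
      have h3 := hφm k
      fun_prop
  -- The partial sums satisfy `S_n ≤ S_{n+1} ≤ |g| + |D| * (|G| S_n)`, so Gronwall bounds them in
  -- `L²(0,T)` uniformly in `n`, and monotone convergence passes to `S`.
  have hS2 : ∀ T : ℝ, ∫⁻ s in Icc 0 T, S s ^ 2 ≠ ⊤ := by
    intro T
    obtain ⟨C, hC, hgr⟩ := h.exists_gronwall T
    have hbound : ∀ n, ∫⁻ s in Icc 0 T, (∑ k ∈ Finset.range n, ‖φ k s‖ₑ) ^ 2
        ≤ C * ∫⁻ s in Icc 0 T, ‖g s‖ₑ ^ 2 := by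
      intro n
      refine hgr _ _ (Finset.measurable_sum _ fun k _ => (hφm k).enorm) hg.enorm
        (lintegral_finset_sum_sq_ne_top _ (fun k _ => (hφm k).enorm) fun k _ => hφ2 k T)
        (Eventually.of_forall fun t => le_trans ?_ (hpart n t))
      exact Finset.sum_le_sum_of_subset (Finset.range_mono (Nat.le_succ n))
    have hlim : Tendsto (fun n => ∫⁻ s in Icc 0 T, (∑ k ∈ Finset.range n, ‖φ k s‖ₑ) ^ 2) atTop
        (𝓝 (∫⁻ s in Icc 0 T, S s ^ 2)) := by
      refine lintegral_tendsto_of_tendsto_of_monotone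
        (fun n => ((Finset.measurable_sum _ fun k _ => (hφm k).enorm).pow_const 2).aemeasurable)
        (Eventually.of_forall fun s m n hmn => ?_) (Eventually.of_forall fun s => ?_)
      · exact pow_le_pow_left₀ zero_le
          (Finset.sum_le_sum_of_subset (Finset.range_mono hmn)) 2
      · exact ENNReal.Tendsto.pow (ENNReal.tendsto_nat_tsum _)
    exact ne_top_of_le_ne_top (ENNReal.mul_ne_top hC (hg2 T)) (le_of_tendsto' hlim hbound)
  have hSfin : ∀ᵐ t ∂volPos, S t < ⊤ := ae_volPos_of_forall_Icc fun T => by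
    filter_upwards [ae_lt_top (hSm.pow_const 2) (hS2 T)] with t ht
    exact (ENNReal.pow_lt_top_iff.1 ht).resolve_right (by norm_num)
  have hsum : ∀ t, S t < ⊤ → Summable fun n => φ n t := fun t ht =>
    Summable.of_enorm ht.ne
  -- Cutting off where `S = ⊤` makes the truncated partial sums converge at every point, which gives
  -- measurability of the limit.
  set χ : ℝ → Fin d → ℝ := fun t => {t | S t < ⊤}.indicator (fun t => ∑' n, φ n t) t with hχ
  have hset : MeasurableSet {t | S t < ⊤} := measurableSet_lt hSm measurable_const
  have hχm : Measurable χ := by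
    refine measurable_of_tendsto_metrizable
      (f := fun n t => {t | S t < ⊤}.indicator (fun t => ∑ k ∈ Finset.range n, φ k t) t)
      (fun n => (Finset.measurable_sum _ fun k _ => hφm k).indicator hset) ?_
    rw [tendsto_pi_nhds]
    intro t
    by_cases ht : S t < ⊤
    · simp only [hχ, indicator_of_mem (show t ∈ {t | S t < ⊤} from ht)]
      exact (hsum t ht).hasSum.tendsto_sum_nat
    · simp only [hχ, indicator_of_notMem (show t ∉ {t | S t < ⊤} from ht)]
      exact tendsto_const_nhds
  have hχS : ∀ t, ‖χ t‖ₑ ≤ S t := by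
    intro t
    by_cases ht : S t < ⊤
    · simp only [hχ, indicator_of_mem (show t ∈ {t | S t < ⊤} from ht)]
      exact enorm_tsum_le_tsum_enorm
    · simp [not_lt_top_iff.1 ht]
  refine ⟨χ, hχm, fun T => ne_top_of_le_ne_top (hS2 T) (lintegral_mono fun t => ?_), ?_⟩
  · gcongr; exact hχS t
  filter_upwards [hSfin, h.ae_majorant_lt_top hSm hS2] with t ht hZ
  have hsfin : ∀ᵐ s, 0 ≤ s → S s < ⊤ := (ae_restrict_iff' measurableSet_Ici).1 hSfin
  have hterm : ∀ᵐ s, D (t - s) * (G s).mulVec (χ s)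
      = ∑' n, D (t - s) * (G s).mulVec (φ n s) := by
    filter_upwards [hsfin] with s hs
    rcases lt_or_ge s 0 with h0 | h0
    · simp [h.mult_neg s h0]
    · have hm : s ∈ {t | S t < ⊤} := hs h0
      simp only [hχ, indicator_of_mem hm]
      let ℓ : (Fin d → ℝ) →L[ℝ] (Fin d → ℝ) :=
        (LinearMap.mulLeft ℝ (D (t - s)) ∘ₗ (G s).mulVecLin).toContinuousLinearMap
      exact ℓ.map_tsum (hsum s (hs h0))
  have hop : volterraOp D G χ t = ∑' n, φ (n + 1) t := by
    rw [volterraOp, integral_congr_ae hterm, integral_tsum]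
    · simp_rw [hφs]; rfl
    · exact fun n => ((h.measurable_integrand (hφm n)).comp
        (measurable_const.prodMk measurable_id)).aestronglyMeasurable
    · refine ne_top_of_le_ne_top hZ.ne ?_
      have h1 := h.kernel_meas
      have h2 := measurable_matrixEnorm h.mult_meas
      simp_rw [hSdef, ← ENNReal.tsum_mul_left]
      rw [lintegral_tsum fun n => by have h3 := hφm n; fun_prop]
      exact ENNReal.tsum_le_tsum fun n => lintegral_mono fun s => enorm_integrand_le t s _
  rw [hop]
  simp only [hχ, indicator_of_mem (show t ∈ {t | S t < ⊤} from ht)]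
  rw [(hsum t ht).tsum_eq_zero_add]
  rfl

end VolterraData

end

/-! ### Comparison of measures and translates of a non-increasing measure -/

theorem continuousWithinAt_measureReal_Iic (μ : Measure ℝ) [IsFiniteMeasure μ] (x : ℝ) :
    ContinuousWithinAt (fun y => μ.real (Iic y)) (Ici x) x := by
  rw [← continuousWithinAt_Ioi_iff_Ici]
  have hI : Iic x = ⋂ r > x, Iic r := by
    ext y
    simp only [mem_Iic, mem_iInter]
    exact ⟨fun h r hr => h.trans (le_of_lt hr), fun h => le_of_forall_gt_imp_ge_of_dense h⟩
  have h := tendsto_measure_biInter_gt (μ := μ) (s := fun r : ℝ => Iic r) (a := x)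
    (fun r _ => measurableSet_Iic.nullMeasurableSet) (fun i j _ hij => Iic_subset_Iic.2 hij)
    ⟨x + 1, by linarith, measure_ne_top _ _⟩
  rw [← hI] at h
  exact (ENNReal.tendsto_toReal (measure_ne_top _ _)).comp h

/-- Finite measures on `ℝ` can be compared on half-open intervals. -/
theorem measure_le_of_Ioc_le {μ ν : Measure ℝ} [IsFiniteMeasure μ] [IsFiniteMeasure ν]
    (h : ∀ a b, a < b → μ (Ioc a b) ≤ ν (Ioc a b)) : μ ≤ ν := by
  have hsplit : ∀ (ρ : Measure ℝ) [IsFiniteMeasure ρ] (a b : ℝ), a ≤ b →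
      ρ.real (Iic b) = ρ.real (Iic a) + ρ.real (Ioc a b) := by
    intro ρ _ a b hab
    rw [← Iic_union_Ioc_eq_Iic hab, measureReal_union (Iic_disjoint_Ioc le_rfl) measurableSet_Ioc]
  have hreal : ∀ a b, a < b → μ.real (Ioc a b) ≤ ν.real (Ioc a b) := fun a b hab =>
    ENNReal.toReal_mono (measure_ne_top _ _) (h a b hab)
  -- The difference of the distribution functions is non-decreasing and right-continuous, so it
  -- defines a measure that completes `μ` to `ν`.
  let D : StieltjesFunction ℝ :=
    { toFun := fun x => ν.real (Iic x) - μ.real (Iic x)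
      mono' := by
        intro a b hab
        rcases hab.eq_or_lt with rfl | hlt
        · exact le_rfl
        · have h1 := hsplit μ a b hab
          have h2 := hsplit ν a b hab
          have h3 := hreal a b hlt
          simp only
          linarith
      right_continuous' := fun x =>
        (continuousWithinAt_measureReal_Iic ν x).sub (continuousWithinAt_measureReal_Iic μ x) }
  have hν : ν = μ + D.measure := by
    refine Measure.ext_of_Ioc _ _ fun a b hab => ?_
    have h1 := hsplit μ a b hab.le
    have h2 := hsplit ν a b hab.le
    have h3 := hreal a b hab
    have h4 : D b - D a = ν.real (Ioc a b) - μ.real (Ioc a b) := by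
      change (ν.real (Iic b) - μ.real (Iic b)) - (ν.real (Iic a) - μ.real (Iic a)) = _
      linarith
    rw [Measure.add_apply, D.measure_Ioc, h4, ← ofReal_measureReal (μ := μ),
      ← ofReal_measureReal (μ := ν), ← ENNReal.ofReal_add measureReal_nonneg (by linarith)]
    congr 1; ring
  rw [hν]
  exact Measure.le_add_right le_rfl

section

variable {L : Measure ℝ}

/-- The hypothesis concerns closed intervals; exhausting `(a+ε, b+ε]` from inside by closed
intervals keeps a possible atom at `a` out of the bound. For `a = 0` this matters, since `L` will
have an atom there. -/
theorem measure_Ioc_add_le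
    (hL : ∀ t : ℝ, 0 ≤ t → AntitoneOn (fun s : ℝ => L (Icc s (s + t))) (Ici 0))
    {ε : ℝ} (hε : 0 ≤ ε) {a b : ℝ} (ha : 0 ≤ a) :
    L (Ioc (a + ε) (b + ε)) ≤ L (Ioc a b) := by
  have hU : Ioc (a + ε) (b + ε) = ⋃ n : ℕ, Icc (a + ε + 1 / ((n : ℝ) + 1)) (b + ε) := by
    ext y
    simp only [mem_Ioc, mem_iUnion, mem_Icc]
    constructor
    · rintro ⟨h1, h2⟩
      obtain ⟨n, hn⟩ := exists_nat_one_div_lt (sub_pos.2 h1)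
      exact ⟨n, by linarith, h2⟩
    · rintro ⟨n, h1, h2⟩
      have : (0 : ℝ) < 1 / ((n : ℝ) + 1) := by positivity
      exact ⟨by linarith, h2⟩
  rw [hU, Monotone.measure_iUnion]
  · refine iSup_le fun n => ?_
    have hn : (0 : ℝ) < 1 / ((n : ℝ) + 1) := by positivity
    rcases lt_or_ge b (a + 1 / ((n : ℝ) + 1)) with hb | hb
    · rw [Icc_eq_empty (by linarith)]; simp
    · have h := hL (b - (a + 1 / ((n : ℝ) + 1))) (by linarith)
        (show a + 1 / ((n : ℝ) + 1) ∈ Ici (0 : ℝ) by simp only [mem_Ici]; linarith)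
        (show a + ε + 1 / ((n : ℝ) + 1) ∈ Ici (0 : ℝ) by simp only [mem_Ici]; linarith)
        (by linarith)
      simp only at h
      rw [show a + ε + 1 / ((n : ℝ) + 1) + (b - (a + 1 / ((n : ℝ) + 1))) = b + ε by ring,
        show a + 1 / ((n : ℝ) + 1) + (b - (a + 1 / ((n : ℝ) + 1))) = b by ring] at h
      exact h.trans (measure_mono fun y hy => ⟨by linarith [hy.1], hy.2⟩)
  · intro m n hmn
    refine Icc_subset_Icc_left ?_
    have := Nat.one_div_le_one_div (α := ℝ) hmn
    linarith

theorem map_sub_restrict_le [IsLocallyFiniteMeasure L]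
    (hL : ∀ t : ℝ, 0 ≤ t → AntitoneOn (fun s : ℝ => L (Icc s (s + t))) (Ici 0))
    {ε : ℝ} (hε : 0 ≤ ε) (c : ℝ) :
    (L.restrict (Ioc ε (c + ε))).map (fun s => s - ε) ≤ L.restrict (Ioc 0 c) := by
  have hm : Measurable fun s : ℝ => s - ε := by fun_prop
  have : IsFiniteMeasure (L.restrict (Ioc ε (c + ε))) :=
    ⟨by rw [Measure.restrict_apply_univ]; exact measure_Ioc_lt_top⟩
  have : IsFiniteMeasure (L.restrict (Ioc 0 c)) :=
    ⟨by rw [Measure.restrict_apply_univ]; exact measure_Ioc_lt_top⟩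
  refine measure_le_of_Ioc_le fun a b _ => ?_
  rw [Measure.map_apply hm measurableSet_Ioc, Measure.restrict_apply (hm measurableSet_Ioc),
    Measure.restrict_apply measurableSet_Ioc, Ioc_inter_Ioc]
  refine le_trans (measure_mono fun s hs => ?_)
    (measure_Ioc_add_le hL hε (a := a ⊔ 0) (b := b ⊓ c) le_sup_right)
  obtain ⟨⟨h1, h2⟩, h3, h4⟩ := hs
  refine ⟨?_, ?_⟩
  · have : a ⊔ 0 < s - ε := sup_lt_iff.2 ⟨h1, by linarith⟩
    linarith
  · have : s - ε ≤ b ⊓ c := le_inf h2 (by linarith)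
    linarith

/-- Substituting `s ↦ s - (τ - σ)` moves `L` on `(τ-σ, τ]` to a measure dominated by `L` on `(0,
σ]`. Thus the values of `x` on `[0, σ)` receive no more weight in `(x * L)(τ)` than in `(x * L)(σ)`.
-/
theorem setIntegral_comp_sub_le [IsLocallyFiniteMeasure L]
    (hL : ∀ t : ℝ, 0 ≤ t → AntitoneOn (fun s : ℝ => L (Icc s (s + t))) (Ici 0))
    {x : ℝ → ℝ} (hx : Continuous x) {σ τ : ℝ} (hστ : σ ≤ τ)
    (hx0 : ∀ t ∈ Icc 0 σ, 0 ≤ x t) :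
    ∫ s in Ioc (τ - σ) τ, x (τ - s) ∂L ≤ ∫ s in Ioc 0 σ, x (σ - s) ∂L := by
  have hm : Measurable fun s : ℝ => s - (τ - σ) := by fun_prop
  have hle := map_sub_restrict_le hL (sub_nonneg.2 hστ) σ
  rw [show σ + (τ - σ) = τ by ring] at hle
  have hc : Continuous fun s => x (σ - s) := by fun_prop
  have hint : IntegrableOn (fun s => x (σ - s)) (Ioc 0 σ) L :=
    (hc.continuousOn.integrableOn_Icc).mono_set Ioc_subset_Icc_self
  have h := integral_mono_measure hle (f := fun s => x (σ - s)) ?_ hint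
  · rw [integral_map hm.aemeasurable hc.aestronglyMeasurable] at h
    simpa only [show ∀ s, σ - (s - (τ - σ)) = τ - s from fun s => by ring] using h
  · filter_upwards [ae_restrict_mem measurableSet_Ioc] with s hs
    exact hx0 _ ⟨by linarith [hs.2], by linarith [hs.1]⟩

theorem setIntegral_Icc_eq_add_Ioc {y : ℝ → ℝ} {t : ℝ} (ht : 0 ≤ t)
    (hy : IntegrableOn y (Icc 0 t) L) :
    ∫ s in Icc 0 t, y s ∂L = L.real {0} * y 0 + ∫ s in Ioc 0 t, y s ∂L := by
  have hu : Icc 0 t = {0} ∪ Ioc 0 t := by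
    rw [singleton_union, Ioc_insert_left ht]
  rw [hu] at hy ⊢
  rw [setIntegral_union (by simp) measurableSet_Ioc (hy.mono_set subset_union_left)
    (hy.mono_set subset_union_right), integral_singleton, smul_eq_mul]

end

/-! ### The scalar equation convolved with the resolvent of the first kind -/

section

variable {k : ℝ → ℝ} {L : Measure ℝ} {C : ℝ}

theorem tendsto_measureReal_Ioc_zero [IsLocallyFiniteMeasure L] :
    Tendsto (fun n : ℕ => L.real (Ioc 0 (1 / ((n : ℝ) + 1)))) atTop (𝓝 0) := by
  have hI : ⋂ n : ℕ, Ioc (0 : ℝ) (1 / ((n : ℝ) + 1)) = ∅ := by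
    refine eq_empty_of_forall_notMem fun y hy => ?_
    rw [mem_iInter] at hy
    obtain ⟨n, hn⟩ := exists_nat_one_div_lt (hy 0).1
    exact absurd (hy n).2 (not_le.2 hn)
  have h := tendsto_measure_iInter_atTop (μ := L)
    (s := fun n : ℕ => Ioc (0 : ℝ) (1 / ((n : ℝ) + 1)))
    (fun n => measurableSet_Ioc.nullMeasurableSet)
    (fun m n hmn => Ioc_subset_Ioc_right (Nat.one_div_le_one_div hmn))
    ⟨0, measure_Ioc_lt_top.ne⟩
  rw [hI, measure_empty] at h
  exact (ENNReal.tendsto_toReal ENNReal.zero_ne_top).comp h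

/-- A resolvent of the first kind of a bounded kernel has an atom at zero. -/
theorem IsNonnegFirstKindResolvent.measureReal_zero_pos (hL : IsNonnegFirstKindResolvent k L)
    (hk : ∀ t, 0 ≤ t → k t ≤ C) : 0 < L.real {0} := by
  have := hL.locallyFinite
  by_contra hneg
  have h0 : L.real {0} = 0 := le_antisymm (not_lt.1 hneg) measureReal_nonneg
  -- Without an atom, `1 = (k * L)(t) ≤ C L((0,t])`, which tends to zero as `t ↓ 0`.
  have hle : ∀ t : ℝ, 0 < t → 1 ≤ C * L.real (Ioc 0 t) := by
    intro t ht
    have hfin : IsFiniteMeasure (L.restrict (Icc 0 t)) :=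
      ⟨by rw [Measure.restrict_apply_univ]; exact measure_Icc_lt_top⟩
    rw [← hL.conv_eq_one t ht, setIntegral_Icc_eq_add_Ioc ht.le (hL.integrable t ht), h0, zero_mul,
      zero_add]
    calc ∫ s in Ioc 0 t, k (t - s) ∂L ≤ ∫ _ in Ioc 0 t, C ∂L := by
          refine setIntegral_mono_on ((hL.integrable t ht).mono_set Ioc_subset_Icc_self)
            (integrableOn_const measure_Ioc_lt_top.ne) measurableSet_Ioc fun s hs => ?_
          exact hk _ (by linarith [hs.2])
      _ = C * L.real (Ioc 0 t) := by simp [mul_comm]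
  have hlim : Tendsto (fun n : ℕ => C * L.real (Ioc 0 (1 / ((n : ℝ) + 1)))) atTop (𝓝 (C * 0)) :=
    tendsto_measureReal_Ioc_zero.const_mul C
  have := ge_of_tendsto' hlim fun n => hle (1 / ((n : ℝ) + 1)) (by positivity)
  norm_num at this

/-- Convolving `x = k u + v + k * f` with the resolvent of the first kind of `k`. -/
theorem IsNonnegFirstKindResolvent.conv_solution (hL : IsNonnegFirstKindResolvent k L)
    (hkm : Measurable k) (hkneg : ∀ t < 0, k t = 0) (hkC : ∀ t, |k t| ≤ C)
    {x f : ℝ → ℝ} {u v t : ℝ} (ht : 0 < t) (hf : IntegrableOn f (Ioc 0 t))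
    (hx : ∀ r ∈ Icc 0 t, x r = k r * u + v + ∫ s in (0 : ℝ)..r, k (r - s) * f s) :
    ∫ s in Icc 0 t, x (t - s) ∂L = u + v * L.real (Icc 0 t) + ∫ s in (0 : ℝ)..t, f s := by
  have := hL.locallyFinite
  have hfin : IsFiniteMeasure (L.restrict (Icc 0 t)) :=
    ⟨by rw [Measure.restrict_apply_univ]; exact measure_Icc_lt_top⟩
  -- Boundedness of `k` makes Fubini available; associativity then gives `L * (k * f) = (L * k) * f
  -- = 1 * f`.
  have hprod : Integrable (fun p : ℝ × ℝ => k (t - p.1 - p.2) * f p.2)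
      ((L.restrict (Icc 0 t)).prod (volume.restrict (Ioc 0 t))) := by
    refine Integrable.bdd_mul (c := C) (hf.integrable.comp_snd (L.restrict (Icc 0 t))) ?_ ?_
    · exact (hkm.comp (by fun_prop)).aestronglyMeasurable
    · exact Eventually.of_forall fun p => hkC _
  have hJ : ∀ s ∈ Icc 0 t, x (t - s) = k (t - s) * u + v +
      ∫ r in Ioc 0 t, k (t - s - r) * f r := by
    intro s hs
    rw [hx (t - s) ⟨by linarith [hs.2], by linarith [hs.1]⟩,
      intervalIntegral.integral_of_le (by linarith [hs.2])]
    congr 1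
    symm
    refine setIntegral_eq_of_subset_of_forall_sdiff_eq_zero measurableSet_Ioc
      (Ioc_subset_Ioc_right (by linarith [hs.1])) fun r hr => ?_
    have : t - s < r := by
      by_contra hh
      exact hr.2 ⟨hr.1.1, not_lt.1 hh⟩
    rw [hkneg _ (by linarith), zero_mul]
  rw [setIntegral_congr_fun measurableSet_Icc hJ, integral_add, integral_add]
  · rw [integral_mul_const, hL.conv_eq_one t ht, integral_integral_swap hprod,
      intervalIntegral.integral_of_le ht.le, one_mul]
    congr 1
    · simp [mul_comm]
    refine integral_congr_ae ?_
    have hne : ∀ᵐ r ∂(volume.restrict (Ioc 0 t)), r ≠ t := ae_restrict_of_ae (by simp [ae_iff])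
    filter_upwards [ae_restrict_mem measurableSet_Ioc, hne] with r hr hrt
    have hrt' : 0 < t - r := sub_pos.2 (lt_of_le_of_ne hr.2 hrt)
    rw [integral_mul_const]
    -- Since `k` vanishes on the negative half-line, the inner integral is `(k * L)(t - r) = 1`.
    have : ∫ s in Icc 0 t, k (t - s - r) ∂L = ∫ s in Icc 0 (t - r), k (t - r - s) ∂L := by
      rw [setIntegral_eq_of_subset_of_forall_sdiff_eq_zero measurableSet_Icc
        (Icc_subset_Icc_right (show t - r ≤ t by linarith [hr.1]))]
      · refine setIntegral_congr_fun measurableSet_Icc fun s _ => ?_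
        rw [sub_right_comm]
      · intro s hs
        refine hkneg _ ?_
        by_contra hh
        exact hs.2 ⟨hs.1.1, by linarith [not_lt.1 hh]⟩
    rw [this, hL.conv_eq_one _ hrt', one_mul]
  · exact (hL.integrable t ht).integrable.mul_const u
  · exact integrable_const v
  · exact ((hL.integrable t ht).integrable.mul_const u).add (integrable_const v)
  · exact hprod.integral_prod_left

/-- A solution of a scalar Volterra equation with nonnegative data cannot reach zero for the first
time at a positive time. -/
theorem IsNonnegFirstKindResolvent.ne_zero_of_pos (hL : IsNonnegFirstKindResolvent k L)
    (hmono : ∀ t : ℝ, 0 ≤ t → AntitoneOn (fun s : ℝ => L (Icc s (s + t))) (Ici 0))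
    (hkm : Measurable k) (hkneg : ∀ t < 0, k t = 0) (hkC : ∀ t, |k t| ≤ C)
    {x f q : ℝ → ℝ} {u v τ : ℝ} (hv : 0 ≤ v) (hτ : 0 < τ) (hxc : Continuous x)
    (hxpos : ∀ t ∈ Ico 0 τ, 0 < x t)
    (hf : IntegrableOn f (Ioc 0 τ)) (hq : ∀ a b, IntervalIntegrable q volume a b)
    (hq0 : ∀ s, 0 ≤ q s) (hfq : ∀ᵐ s ∂(volume.restrict (Ioc 0 τ)), -(q s * x s) ≤ f s)
    (hx : ∀ r ∈ Icc 0 τ, x r = k r * u + v + ∫ s in (0 : ℝ)..r, k (r - s) * f s) :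
    x τ ≠ 0 := by
  intro hxτ
  have := hL.locallyFinite
  have hL0 := hL.measureReal_zero_pos (fun t _ => (le_abs_self _).trans (hkC t))
  -- Both `L((0,δ])` and `∫_{τ-δ}^τ q` tend to zero with `δ`, while the atom `L({0})` is fixed and
  -- positive.
  obtain ⟨δ, hδ0, hδτ, hδ⟩ : ∃ δ : ℝ, 0 < δ ∧ δ < τ ∧
      L.real (Ioc 0 δ) + ∫ s in (τ - δ)..τ, q s < L.real {0} := by
    have hd : Tendsto (fun n : ℕ => 1 / ((n : ℝ) + 1)) atTop (𝓝 0) :=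
      tendsto_one_div_add_atTop_nhds_zero_nat
    have hprim : Continuous fun δ => ∫ s in (τ - δ)..τ, q s := by
      rw [show (fun δ => ∫ s in (τ - δ)..τ, q s) = fun δ => -∫ s in τ..(τ - δ), q s from
        funext fun δ => intervalIntegral.integral_symm _ _]
      exact ((intervalIntegral.continuous_primitive hq τ).comp
        (continuous_const.sub continuous_id)).neg
    have h2 := (hprim.tendsto 0).comp hd
    simp only [sub_zero, intervalIntegral.integral_same] at h2
    have h3 := (tendsto_measureReal_Ioc_zero (L := L)).add h2
    rw [add_zero] at h3
    obtain ⟨n, hn1, hn2⟩ := (((tendsto_order.1 h3).2 _ hL0).and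
      ((tendsto_order.1 hd).2 _ hτ)).exists
    exact ⟨_, by positivity, hn2, hn1⟩
  obtain ⟨σ, hσ, hmax⟩ := (isCompact_Icc (a := τ - δ) (b := τ)).exists_isMaxOn
    (nonempty_Icc.2 (by linarith)) hxc.continuousOn
  have hMpos : 0 < x σ :=
    (hxpos (τ - δ) ⟨by linarith, by linarith⟩).trans_le (hmax ⟨le_rfl, by linarith⟩)
  have hστ : σ < τ := lt_of_le_of_ne hσ.2 fun h => by rw [h, hxτ] at hMpos; exact lt_irrefl _ hMpos
  have hσ0 : 0 < σ := by linarith [hσ.1]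
  have hxnn : ∀ t ∈ Icc 0 τ, 0 ≤ x t := fun t ht => by
    rcases ht.2.eq_or_lt with h | h
    · rw [h, hxτ]
    · exact (hxpos t ⟨ht.1, h⟩).le
  have hIτ := hL.conv_solution hkm hkneg hkC hτ hf hx
  have hIσ := hL.conv_solution hkm hkneg hkC hσ0 (hf.mono_set (Ioc_subset_Ioc_right hστ.le))
    (fun r hr => hx r ⟨hr.1, hr.2.trans hστ.le⟩)
  have hcτ : Continuous fun s => x (τ - s) := by fun_prop
  have hcσ : Continuous fun s => x (σ - s) := by fun_prop
  -- At `τ` the atom term drops out because `x τ = 0`. The rest is split at `s = τ - σ` into recent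
  -- times, where `x ≤ x σ`, and the history before `σ`.
  rw [setIntegral_Icc_eq_add_Ioc hτ.le hcτ.continuousOn.integrableOn_Icc, sub_zero, hxτ, mul_zero,
    zero_add, ← Ioc_union_Ioc_eq_Ioc (sub_nonneg.2 hστ.le) (by linarith : τ - σ ≤ τ),
    setIntegral_union (Ioc_disjoint_Ioc_of_le le_rfl) measurableSet_Ioc
      (hcτ.continuousOn.integrableOn_Icc.mono_set Ioc_subset_Icc_self)
      (hcτ.continuousOn.integrableOn_Icc.mono_set Ioc_subset_Icc_self)] at hIτ
  rw [setIntegral_Icc_eq_add_Ioc hσ0.le hcσ.continuousOn.integrableOn_Icc, sub_zero] at hIσ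
  have hA : ∫ s in Ioc 0 (τ - σ), x (τ - s) ∂L ≤ x σ * L.real (Ioc 0 δ) := by
    calc ∫ s in Ioc 0 (τ - σ), x (τ - s) ∂L ≤ ∫ _ in Ioc 0 (τ - σ), x σ ∂L := by
          refine setIntegral_mono_on
            (hcτ.continuousOn.integrableOn_Icc.mono_set Ioc_subset_Icc_self)
            (integrableOn_const measure_Ioc_lt_top.ne) measurableSet_Ioc fun s hs => ?_
          exact hmax ⟨by linarith [hs.2, hσ.1], by linarith [hs.1]⟩
      _ = x σ * L.real (Ioc 0 (τ - σ)) := by simp [mul_comm]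
      _ ≤ _ := by
          gcongr
          · exact measure_Ioc_lt_top.ne
          · linarith [hσ.1]
  have hB := setIntegral_comp_sub_le hmono hxc hστ.le
    (fun t ht => hxnn t ⟨ht.1, ht.2.trans hστ.le⟩)
  have hLmono : L.real (Icc 0 σ) ≤ L.real (Icc 0 τ) :=
    measureReal_mono (Icc_subset_Icc_right hστ.le) measure_Icc_lt_top.ne
  have hfi : ∀ a b, 0 ≤ a → a ≤ b → b ≤ τ → IntervalIntegrable f volume a b := by
    intro a b ha hab hb
    rw [intervalIntegrable_iff_integrableOn_Ioc_of_le hab]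
    exact hf.mono_set (Ioc_subset_Ioc ha hb)
  have hadd := intervalIntegral.integral_add_adjacent_intervals (hfi 0 σ le_rfl hσ0.le hστ.le)
    (hfi σ τ hσ0.le hστ.le le_rfl)
  have hF : -(x σ * ∫ s in (τ - δ)..τ, q s) ≤ ∫ s in σ..τ, f s := by
    calc -(x σ * ∫ s in (τ - δ)..τ, q s) ≤ -(x σ * ∫ s in σ..τ, q s) := by
          gcongr
          exact intervalIntegral.integral_mono_interval hσ.1 hστ.le le_rfl
            (Eventually.of_forall hq0) (hq _ _)
      _ = ∫ s in σ..τ, -(x σ * q s) := by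
          rw [intervalIntegral.integral_neg, intervalIntegral.integral_const_mul]
      _ ≤ _ := by
          refine intervalIntegral.integral_mono_ae_restrict hστ.le ((hq _ _).const_mul _).neg
            (hfi σ τ hσ0.le hστ.le le_rfl) ?_
          rw [← restrict_Ioc_eq_restrict_Icc]
          filter_upwards [ae_restrict_mem measurableSet_Ioc,
            ae_restrict_of_ae_restrict_of_subset (Ioc_subset_Ioc_left hσ0.le) hfq] with s hs hs2
          refine le_trans ?_ hs2
          rw [neg_le_neg_iff, mul_comm]
          exact mul_le_mul_of_nonneg_right (hmax ⟨by linarith [hs.1, hσ.1], hs.2⟩) (hq0 s)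
  have h5 : v * L.real (Icc 0 σ) ≤ v * L.real (Icc 0 τ) := by gcongr
  -- Subtracting the two identities cancels `u` and forces `x σ * L {0} ≤ x σ * (L (0, δ] + ∫ q)`,
  -- which contradicts the choice of `δ`.
  have h6 : x σ * (L.real (Ioc 0 δ) + ∫ s in (τ - δ)..τ, q s) < x σ * L.real {0} := by gcongr
  rw [mul_add, mul_comm (x σ) (L.real {0})] at h6
  linarith

end

/-! ### Extended solutions: existence, stability and uniqueness -/

section

variable {d : ℕ}

/-- A measurable function in `L¹_loc(ℝ₊)`, extended by zero to the negative half-line. -/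
structure ForcingData (f : ℝ → Fin d → ℝ) : Prop where
  meas : Measurable f
  neg : ∀ t < 0, f t = 0
  int : ∀ T : ℝ, ∫⁻ s in Icc 0 T, ‖f s‖ₑ ≠ ⊤

theorem ForcingData.integrableOn {f : ℝ → Fin d → ℝ} (hf : ForcingData f) (i : Fin d) (T : ℝ) :
    IntegrableOn (fun s => f s i) (Icc 0 T) :=
  ⟨((measurable_pi_apply i).comp hf.meas).aestronglyMeasurable,
    (lintegral_mono fun s => enorm_apply_le (f s) i).trans_lt (hf.int T).lt_top⟩

/-- `χ` is a measurable `L²_loc` solution of `χ = D u + v + D * (F + G χ)`, where all functions are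
extended by zero to the negative half-line. -/
structure IsExtendedSolution (D : ℝ → Fin d → ℝ) (G : ℝ → Matrix (Fin d) (Fin d) ℝ)
    (F : ℝ → Fin d → ℝ) (u v : Fin d → ℝ) (χ : ℝ → Fin d → ℝ) : Prop where
  meas : Measurable χ
  sq : ∀ T : ℝ, ∫⁻ s in Icc 0 T, ‖χ s‖ₑ ^ 2 ≠ ⊤
  integrable : ∀ᵐ t ∂volPos, Integrable fun s => D (t - s) * (F s + (G s).mulVec (χ s))
  equation : ∀ᵐ t ∂volPos,
    χ t = D t * u + v + ∫ s, D (t - s) * (F s + (G s).mulVec (χ s))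

namespace VolterraData

variable {D : ℝ → Fin d → ℝ} {G : ℝ → Matrix (Fin d) (Fin d) ℝ}

theorem measurable_conv_integrand (h : VolterraData D G) {f : ℝ → Fin d → ℝ}
    (hf : ForcingData f) : Measurable fun p : ℝ × ℝ => D (p.1 - p.2) * f p.2 :=
  (h.kernel_meas.comp (measurable_fst.sub measurable_snd)).mul (hf.meas.comp measurable_snd)

theorem measurable_conv_majorant (h : VolterraData D G) {f : ℝ → Fin d → ℝ}
    (hf : ForcingData f) : Measurable fun t => ∫⁻ s, ‖D (t - s)‖ₑ * ‖f s‖ₑ := by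
  have h1 := h.kernel_meas
  have h2 := hf.meas
  exact Measurable.lintegral_prod_right' (f := fun p : ℝ × ℝ => ‖D (p.1 - p.2)‖ₑ * ‖f p.2‖ₑ)
    (by fun_prop)

theorem conv_majorant_sq_ne_top (h : VolterraData D G) {f : ℝ → Fin d → ℝ} (hf : ForcingData f)
    (T : ℝ) : ∫⁻ t in Icc 0 T, (∫⁻ s, ‖D (t - s)‖ₑ * ‖f s‖ₑ) ^ 2 ≠ ⊤ :=
  ne_top_of_le_ne_top (ENNReal.mul_ne_top (h.kernel_sq T) (ENNReal.pow_ne_top (hf.int T)))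
    (setLIntegral_convolution_sq_le h.kernel_meas.enorm hf.meas.enorm h.enorm_kernel_neg
      (fun t ht => by simp [hf.neg t ht]) T)

theorem ae_integrable_conv (h : VolterraData D G) {f : ℝ → Fin d → ℝ} (hf : ForcingData f) :
    ∀ᵐ t ∂volPos, Integrable fun s => D (t - s) * f s := by
  refine ae_volPos_of_forall_Icc fun T => ?_
  filter_upwards [ae_lt_top ((h.measurable_conv_majorant hf).pow_const 2)
    (h.conv_majorant_sq_ne_top hf T)] with t ht
  refine ⟨((h.measurable_conv_integrand hf).comp
    (measurable_const.prodMk measurable_id)).aestronglyMeasurable, ?_⟩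
  exact (lintegral_mono fun s => enorm_pi_mul_le _ _).trans_lt
    ((ENNReal.pow_lt_top_iff.1 ht).resolve_right (by norm_num))

/-- Cauchy–Schwarz: a product of two `L²` functions is in `L¹`. The term `G χ` can therefore be
treated as part of the forcing. -/
theorem forcingData_mulVec (h : VolterraData D G) {χ : ℝ → Fin d → ℝ} (hχ : Measurable χ)
    (hχ2 : ∀ T : ℝ, ∫⁻ s in Icc 0 T, ‖χ s‖ₑ ^ 2 ≠ ⊤) :
    ForcingData fun s => (G s).mulVec (χ s) where
  meas := Measurable.mulVec h.mult_meas hχ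
  neg t ht := by simp [h.mult_neg t ht]
  int T := by
    refine ne_top_of_le_ne_top ?_ (lintegral_mono fun s => enorm_mulVec_le _ _)
    have h1 := lintegral_mul_sq_le (volume.restrict (Icc 0 T))
      (measurable_matrixEnorm h.mult_meas).aemeasurable hχ.enorm.aemeasurable
    have h2 := ne_top_of_le_ne_top (ENNReal.mul_ne_top (h.mult_sq T) (hχ2 T)) h1
    simpa using h2

end VolterraData

theorem ForcingData.add {f g : ℝ → Fin d → ℝ} (hf : ForcingData f) (hg : ForcingData g) :
    ForcingData fun s => f s + g s where
  meas := hf.meas.add hg.meas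
  neg t ht := by simp [hf.neg t ht, hg.neg t ht]
  int T := by
    refine ne_top_of_le_ne_top (ENNReal.add_ne_top.2 ⟨hf.int T, hg.int T⟩) ?_
    rw [← lintegral_add_left hf.meas.enorm]
    exact lintegral_mono fun s => enorm_add_le _ _

namespace VolterraData

variable {D : ℝ → Fin d → ℝ} {G : ℝ → Matrix (Fin d) (Fin d) ℝ} {F : ℝ → Fin d → ℝ}
  {u v : Fin d → ℝ}

theorem exists_isExtendedSolution (h : VolterraData D G) (hF : ForcingData F)
    (u v : Fin d → ℝ) : ∃ χ, IsExtendedSolution D G F u v χ := by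
  have hint : Measurable fun t => ∫ s, D (t - s) * F s :=
    ((h.measurable_conv_integrand hF).stronglyMeasurable.integral_prod_right).measurable
  have hDm := h.kernel_meas
  obtain ⟨χ, hm, hsq, heq⟩ := h.exists_solution
    (g := fun t => D t * u + v + ∫ s, D (t - s) * F s) (by fun_prop) (fun T => by
      have hle : ∀ t, ‖D t * u + v + ∫ s, D (t - s) * F s‖ₑ ^ 2
          ≤ (‖D t‖ₑ * ‖u‖ₑ + ‖v‖ₑ + ∫⁻ s, ‖D (t - s)‖ₑ * ‖F s‖ₑ) ^ 2 := by
        intro t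
        gcongr
        refine (enorm_add_le _ _).trans (add_le_add ((enorm_add_le _ _).trans
          (add_le_add (enorm_pi_mul_le _ _) le_rfl)) ?_)
        exact (enorm_integral_le_lintegral_enorm _).trans
          (lintegral_mono fun s => enorm_pi_mul_le _ _)
      refine ne_top_of_le_ne_top (lintegral_add_sq_ne_top (by fun_prop)
        (lintegral_add_sq_ne_top (by fun_prop) ?_ ?_) (h.conv_majorant_sq_ne_top hF T))
        (lintegral_mono hle)
      · simp_rw [mul_pow]
        rw [lintegral_mul_const' _ _ (by finiteness)]
        exact ENNReal.mul_ne_top (h.kernel_sq T) (by finiteness)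
      · rw [lintegral_const]
        refine ENNReal.mul_ne_top (by finiteness) ?_
        rw [Measure.restrict_apply_univ]
        exact measure_Icc_lt_top.ne)
  have hGf := h.forcingData_mulVec hm hsq
  refine ⟨χ, hm, hsq, h.ae_integrable_conv (hF.add hGf), ?_⟩
  filter_upwards [heq, h.ae_integrable_conv hF, h.ae_integrable_conv hGf] with t h1 h2 h3
  rw [h1, volterraOp, add_assoc, ← integral_add h2 h3]
  simp_rw [mul_add]

/-- `L²` stability of solutions under perturbation of the kernel and the constant term. -/
theorem exists_stability (h : VolterraData D G) (hF : ForcingData F) {χ : ℝ → Fin d → ℝ}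
    (hχ : IsExtendedSolution D G F u v χ) (T : ℝ) :
    ∃ C : ENNReal, C ≠ ⊤ ∧ ∀ (D' : ℝ → Fin d → ℝ) (v' : Fin d → ℝ) (χ' : ℝ → Fin d → ℝ),
      VolterraData D' G → (∀ t ≠ 0, ‖D' t‖ₑ ≤ ‖D t‖ₑ) →
      IsExtendedSolution D' G F u v' χ' →
      ∫⁻ t in Icc 0 T, ‖χ' t - χ t‖ₑ ^ 2
        ≤ C * ((∫⁻ t in Icc 0 T, ‖D' t - D t‖ₑ ^ 2) + ‖v' - v‖ₑ ^ 2) := by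
  obtain ⟨C, hC, hgr⟩ := h.exists_gronwall T
  set f : ℝ → Fin d → ℝ := fun s => F s + (G s).mulVec (χ s) with hfdef
  have hf : ForcingData f := hF.add (h.forcingData_mulVec hχ.meas hχ.sq)
  set V := volume (Icc 0 T) with hV
  have hVfin : V ≠ ⊤ := measure_Icc_lt_top.ne
  set I := ∫⁻ s in Icc 0 T, ‖f s‖ₑ with hI
  refine ⟨C * (4 * ‖u‖ₑ ^ 2 + 4 * V + 2 * I ^ 2), by
    have := hf.int T; finiteness, fun D' v' χ' h' hle hχ' => ?_⟩
  set ψ : ℝ → ENNReal := fun t => (‖D' t - D t‖ₑ * ‖u‖ₑ + ‖v' - v‖ₑ) +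
    ∫⁻ s, ‖D' (t - s) - D (t - s)‖ₑ * ‖f s‖ₑ with hψ
  have hm1 := h.kernel_meas
  have hm2 := h'.kernel_meas
  have hm3 := hf.meas
  have hm4 := hχ.meas
  have hm5 := hχ'.meas
  have hψ1 : Measurable fun t => ∫⁻ s, ‖D' (t - s) - D (t - s)‖ₑ * ‖f s‖ₑ :=
    Measurable.lintegral_prod_right'
      (f := fun p : ℝ × ℝ => ‖D' (p.1 - p.2) - D (p.1 - p.2)‖ₑ * ‖f p.2‖ₑ) (by fun_prop)
  have hψm : Measurable ψ := by fun_prop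
  have hsq : ∫⁻ t in Icc 0 T, ‖χ' t - χ t‖ₑ ^ 2 ≠ ⊤ := by
    refine ne_top_of_le_ne_top (lintegral_add_sq_ne_top hm5.enorm (hχ'.sq T) (hχ.sq T))
      (lintegral_mono fun t => ?_)
    gcongr
    exact enorm_sub_le
  have hgr' := hgr (fun t => ‖χ' t - χ t‖ₑ) ψ (by fun_prop) hψm hsq (by
    refine ae_Icc_of_ae_volPos ?_ T
    filter_upwards [hχ.equation, hχ'.equation, hχ.integrable, hχ'.integrable,
      h'.ae_integrable_conv hf] with t e1 e2 i1 i2 i3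
    -- With `f = F + G χ` frozen, the difference solves a Volterra equation with kernel `D'` and
    -- source `(D' - D) u + (v' - v) + (D' - D) * f`. As `|D'| ≤ |D|` away from zero, the Gronwall
    -- constant of `D` serves every `D'`.
    have hdiff : χ' t - χ t = ((D' t - D t) * u + (v' - v)) +
        (∫ s, (D' (t - s) - D (t - s)) * f s) + volterraOp D' G (fun s => χ' s - χ s) t := by
      have e3 : ∫ s, (D' (t - s) - D (t - s)) * f s
          = (∫ s, D' (t - s) * f s) - ∫ s, D (t - s) * f s := by
        rw [← integral_sub i3 i1]
        simp_rw [sub_mul]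
        rfl
      have e4 : volterraOp D' G (fun s => χ' s - χ s) t
          = (∫ s, D' (t - s) * (F s + (G s).mulVec (χ' s))) - ∫ s, D' (t - s) * f s := by
        rw [← integral_sub i2 i3, volterraOp]
        refine integral_congr_ae (Eventually.of_forall fun s => ?_)
        simp only [hfdef, Matrix.mulVec_sub]
        ring
      rw [e3, e4, e1, e2]
      ring
    rw [hdiff]
    refine (enorm_add_le _ _).trans (add_le_add ((enorm_add_le _ _).trans (add_le_add
      ((enorm_add_le _ _).trans (add_le_add (enorm_pi_mul_le _ _) le_rfl)) ?_)) ?_)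
    · exact (enorm_integral_le_lintegral_enorm _).trans
          (lintegral_mono fun s => enorm_pi_mul_le _ _)
    · refine (enorm_op_le t _).trans (lintegral_mono_ae ?_)
      have hne : ∀ᵐ s : ℝ, s ≠ t := by simp [ae_iff]
      filter_upwards [hne] with s hs
      gcongr
      exact hle _ (sub_ne_zero.2 hs.symm))
  refine hgr'.trans ?_
  rw [mul_assoc]
  gcongr
  set e := ∫⁻ t in Icc 0 T, ‖D' t - D t‖ₑ ^ 2
  set w := ‖v' - v‖ₑ ^ 2
  have hY := setLIntegral_convolution_sq_le (a := fun t => ‖D' t - D t‖ₑ) (f := fun s => ‖f s‖ₑ)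
    (by fun_prop) (by fun_prop) (fun t ht => by simp [h.kernel_neg t ht, h'.kernel_neg t ht])
    (fun t ht => by simp [hf.neg t ht]) T
  calc ∫⁻ t in Icc 0 T, ψ t ^ 2
      ≤ ∫⁻ t in Icc 0 T, 2 * (2 * ((‖D' t - D t‖ₑ * ‖u‖ₑ) ^ 2 + ‖v' - v‖ₑ ^ 2) +
          (∫⁻ s, ‖D' (t - s) - D (t - s)‖ₑ * ‖f s‖ₑ) ^ 2) := by
        refine lintegral_mono fun t => (ENNReal.add_sq_le _ _).trans ?_
        gcongr
        exact ENNReal.add_sq_le _ _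
    _ = 2 * (2 * (e * ‖u‖ₑ ^ 2 + w * V) +
          ∫⁻ t in Icc 0 T, (∫⁻ s, ‖D' (t - s) - D (t - s)‖ₑ * ‖f s‖ₑ) ^ 2) := by
        rw [lintegral_const_mul _ (by fun_prop), lintegral_add_right _ (by fun_prop),
          lintegral_const_mul _ (by fun_prop), lintegral_add_right _ (by fun_prop),
          lintegral_const, Measure.restrict_apply_univ]
        simp_rw [mul_pow]
        rw [lintegral_mul_const _ (by fun_prop)]
    _ ≤ 2 * (2 * (e * ‖u‖ₑ ^ 2 + w * V) + e * I ^ 2) := by gcongr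
    _ = 4 * ‖u‖ₑ ^ 2 * e + 4 * V * w + 2 * I ^ 2 * e := by ring
    _ ≤ 4 * ‖u‖ₑ ^ 2 * (e + w) + 4 * V * (e + w) + 2 * I ^ 2 * (e + w) := by
        gcongr
        exacts [le_self_add, le_add_self, le_self_add]
    _ = _ := by ring

theorem ae_eq_of_isExtendedSolution (h : VolterraData D G) (hF : ForcingData F)
    {χ χ' : ℝ → Fin d → ℝ} (hχ : IsExtendedSolution D G F u v χ)
    (hχ' : IsExtendedSolution D G F u v χ') : χ' =ᵐ[volPos] χ := by
  refine ae_volPos_of_forall_Icc fun T => ?_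
  obtain ⟨C, _, hst⟩ := h.exists_stability hF hχ T
  have h0 := hst D v χ' h (fun _ _ => le_rfl) hχ'
  simp only [sub_self, enorm_zero, ne_eq, OfNat.ofNat_ne_zero, not_false_eq_true, zero_pow,
    lintegral_zero, add_zero, mul_zero, nonpos_iff_eq_zero] at h0
  have hm4 := hχ.meas
  have hm5 := hχ'.meas
  rw [lintegral_eq_zero_iff (by fun_prop)] at h0
  filter_upwards [h0] with t ht
  simpa [sub_eq_zero] using ht

end VolterraData

end

/-! ### Positivity for bounded kernels -/

/-- Dominated convergence: for fixed `t₀`, the possible jump of `k` at zero is met only at the null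
point `s = t₀`. -/
theorem continuous_convolution_of_bounded {k f : ℝ → ℝ} {C : ℝ} (hkm : Measurable k)
    (hkneg : ∀ t < 0, k t = 0) (hkC : ∀ t, |k t| ≤ C) (hkc : ContinuousOn k (Ici 0))
    (hfm : Measurable f) (hfneg : ∀ t < 0, f t = 0)
    (hf : ∀ T : ℝ, IntegrableOn f (Icc 0 T)) : Continuous fun t => ∫ s, k (t - s) * f s := by
  rw [continuous_iff_continuousAt]
  intro t₀
  refine continuousAt_of_dominated
    (bound := fun s => C * ‖(Icc 0 (t₀ + 1)).indicator f s‖) ?_ ?_ ?_ ?_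
  · refine Eventually.of_forall fun t => Measurable.aestronglyMeasurable ?_
    exact (hkm.comp (measurable_const.sub measurable_id)).mul hfm
  · filter_upwards [Iio_mem_nhds (lt_add_one t₀)] with t ht
    refine Eventually.of_forall fun s => ?_
    by_cases hs : s ∈ Icc 0 (t₀ + 1)
    · rw [indicator_of_mem hs, norm_mul]
      gcongr
      exact hkC _
    · have : k (t - s) * f s = 0 := by
        rcases lt_or_ge s 0 with h0 | h0
        · rw [hfneg s h0, mul_zero]
        · have : t₀ + 1 < s := by by_contra hh; exact hs ⟨h0, not_lt.1 hh⟩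
          rw [hkneg _ (by linarith [mem_Iio.1 ht]), zero_mul]
      simp [this, hs]
  · exact ((integrable_indicator_iff measurableSet_Icc).2 (hf (t₀ + 1))).norm.const_mul C
  · have hne : ∀ᵐ s : ℝ, s ≠ t₀ := by simp [ae_iff]
    filter_upwards [hne] with s hs
    refine ContinuousAt.mul ?_ continuousAt_const
    have hk : ContinuousAt k (t₀ - s) := by
      rcases lt_or_gt_of_ne hs with h | h
      · exact hkc.continuousAt (Ici_mem_nhds (by linarith))
      · have : k =ᶠ[𝓝 (t₀ - s)] fun _ => 0 := by
          filter_upwards [Iio_mem_nhds (show t₀ - s < 0 by linarith)] with r hr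
          exact hkneg r hr
        exact continuousAt_const.congr this.symm
    exact ContinuousAt.comp' (f := fun t => t - s) hk (by fun_prop)

section

variable {d : ℕ}

/-- Positivity of continuous solutions of Volterra systems with bounded kernels. -/
theorem pos_of_continuous_solution {k : Fin d → ℝ → ℝ} {C : ℝ}
    (hkm : ∀ i, Measurable (k i)) (hkneg : ∀ i, ∀ t < 0, k i t = 0) (hkC : ∀ i t, |k i t| ≤ C)
    (hk0 : ∀ i, 0 ≤ k i 0)
    (hL : ∀ i, ∃ L : Measure ℝ, IsNonnegFirstKindResolvent (k i) L ∧
      ∀ t : ℝ, 0 ≤ t → AntitoneOn (fun s : ℝ => L (Icc s (s + t))) (Ici 0))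
    {G : ℝ → Matrix (Fin d) (Fin d) ℝ} {F y : ℝ → Fin d → ℝ} {u v : Fin d → ℝ}
    (hu : ∀ i, 0 ≤ u i) (hv : ∀ i, 0 < v i) (hF : ∀ᵐ t ∂volPos, ∀ i, 0 ≤ F t i)
    (hG : ∀ᵐ t ∂volPos, ∀ i j, i ≠ j → 0 ≤ G t i j)
    (hGi : ∀ i a b, IntervalIntegrable (fun s => |G s i i|) volume a b)
    (hy : Continuous y)
    (hf : ∀ i (T : ℝ), IntegrableOn (fun s => F s i + (G s).mulVec (y s) i) (Ioc 0 T))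
    (heq : ∀ t, 0 ≤ t → ∀ i, y t i = k i t * u i + v i +
      ∫ s in (0 : ℝ)..t, k i (t - s) * (F s i + (G s).mulVec (y s) i)) :
    ∀ t, 0 ≤ t → ∀ i, 0 < y t i := by
  have hyi : ∀ i, Continuous fun t => y t i := fun i => (continuous_apply i).comp hy
  by_contra! hcon
  obtain ⟨t₁, ht₁, i₁, hi₁⟩ := hcon
  set Z : Set ℝ := Ici 0 ∩ ⋃ i, {t | y t i ≤ 0} with hZ
  have hZc : IsClosed Z := isClosed_Ici.inter
    (isClosed_iUnion_of_finite fun i => isClosed_le (hyi i) continuous_const)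
  have hZne : Z.Nonempty := ⟨t₁, ht₁, mem_iUnion.2 ⟨i₁, hi₁⟩⟩
  have hZb : BddBelow Z := ⟨0, fun t ht => ht.1⟩
  have hτZ := hZc.csInf_mem hZne hZb
  set τ := sInf Z
  obtain ⟨hτ0, hτi⟩ := hτZ
  obtain ⟨i, hi⟩ := mem_iUnion.1 hτi
  have hpos : ∀ t ∈ Ico 0 τ, ∀ j, 0 < y t j := by
    intro t ht j
    by_contra hneg
    exact absurd (csInf_le hZb ⟨ht.1, mem_iUnion.2 ⟨j, not_lt.1 hneg⟩⟩) (not_le.2 ht.2)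
  -- At time zero the equation gives `y_i(0) = k_i(0) u_i + v_i > 0`; strict positivity of `v` is
  -- needed here.
  have hτpos : 0 < τ := by
    refine lt_of_le_of_ne hτ0 fun h0 => ?_
    have h1 := heq 0 le_rfl i
    rw [intervalIntegral.integral_same, add_zero] at h1
    have h2 : y τ i ≤ 0 := hi
    rw [← h0] at h2
    linarith [mul_nonneg (hk0 i) (hu i), hv i]
  have hyτ : y τ i = 0 := by
    refine le_antisymm hi ?_
    have hcl : τ ∈ closure (Ico 0 τ) := by
      rw [closure_Ico hτpos.ne]; exact ⟨hτ0, le_rfl⟩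
    have hsub : closure (Ico 0 τ) ⊆ {t | 0 ≤ y t i} :=
      closure_minimal (fun t ht => (hpos t ht i).le) (isClosed_le continuous_const (hyi i))
    exact hsub hcl
  obtain ⟨L, hL1, hL2⟩ := hL i
  refine hL1.ne_zero_of_pos hL2 (hkm i) (hkneg i) (hkC i) (x := fun t => y t i)
    (q := fun s => |G s i i|) (hv i).le hτpos (hyi i) (fun t ht => hpos t ht i) (hf i τ) (hGi i)
    (fun s => abs_nonneg _) ?_ (fun r hr => heq r hr.1 i) hyτ
  have hsub : Ioc 0 τ ⊆ Ici (0 : ℝ) := fun s hs => hs.1.le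
  have hne : ∀ᵐ r ∂(volume.restrict (Ioc 0 τ)), r ≠ τ := ae_restrict_of_ae (by simp [ae_iff])
  filter_upwards [ae_restrict_of_ae_restrict_of_subset hsub hF,
    ae_restrict_of_ae_restrict_of_subset hsub hG, ae_restrict_mem measurableSet_Ioc, hne]
    with s hFs hGs hs hsτ
  have hys := hpos s ⟨hs.1.le, lt_of_le_of_ne hs.2 hsτ⟩
  -- Before `τ` all components are positive, so the off-diagonal entries of `G` only help.
  have hsum : G s i i * y s i ≤ (G s).mulVec (y s) i := by
    rw [Matrix.mulVec, dotProduct, ← Finset.add_sum_erase _ _ (Finset.mem_univ i)]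
    refine le_add_of_nonneg_right (Finset.sum_nonneg fun j hj => ?_)
    exact mul_nonneg (hGs i j (Finset.ne_of_mem_erase hj).symm) (hys j).le
  have habs : -(|G s i i| * y s i) ≤ G s i i * y s i := by
    rw [← neg_mul]
    exact mul_le_mul_of_nonneg_right (neg_abs_le _) (hys i).le
  linarith [hFs i]

variable {D : ℝ → Fin d → ℝ} {G : ℝ → Matrix (Fin d) (Fin d) ℝ}

theorem VolterraData.intervalIntegrable_diag (h : VolterraData D G) (i : Fin d) (a b : ℝ) :
    IntervalIntegrable (fun s => |G s i i|) volume a b := by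
  set T := max a b
  have hm : Measurable fun s => |G s i i| := (h.mult_meas i i).norm
  have hle : ∀ s, ‖|G s i i|‖ₑ ≤ matrixEnorm (G s) := fun s => by
    rw [← Real.norm_eq_abs, enorm_norm]
    exact (Finset.single_le_sum (f := fun j => ‖G s i j‖ₑ) (fun _ _ => zero_le)
      (Finset.mem_univ i)).trans (Finset.single_le_sum (f := fun i => ∑ j, ‖G s i j‖ₑ)
        (fun _ _ => zero_le) (Finset.mem_univ i))
  have hfin : ∫⁻ s in Icc 0 T, matrixEnorm (G s) < ⊤ := by
    have h1 := lintegral_mul_sq_le (volume.restrict (Icc 0 T)) (g := fun _ => 1)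
      (measurable_matrixEnorm h.mult_meas).aemeasurable measurable_const.aemeasurable
    have h2 := ne_top_of_le_ne_top (ENNReal.mul_ne_top (h.mult_sq T) (by simp)) h1
    simp only [mul_one] at h2
    exact lt_top_iff_ne_top.2 fun h3 => h2 (by simp [h3])
  have hint : IntegrableOn (fun s => |G s i i|) (Icc 0 T) :=
    ⟨hm.aestronglyMeasurable, (lintegral_mono hle).trans_lt hfin⟩
  have h3 := ((integrable_indicator_iff measurableSet_Icc).2 hint).intervalIntegrable
    (a := a) (b := b)
  refine h3.congr fun s hs => ?_
  rcases lt_or_ge s 0 with h0 | h0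
  · simp [h.mult_neg s h0]
  · exact indicator_of_mem (show s ∈ Icc 0 T from ⟨h0, hs.2⟩) _

/-- Positivity of solutions when the kernel is bounded. -/
theorem IsExtendedSolution.nonneg_of_bounded (h : VolterraData D G) {F : ℝ → Fin d → ℝ}
    (hFd : ForcingData F) {u v : Fin d → ℝ} {χ : ℝ → Fin d → ℝ}
    (hχ : IsExtendedSolution D G F u v χ) {C : ℝ} (hDC : ∀ t i, |D t i| ≤ C)
    (hD0 : ∀ i, 0 ≤ D 0 i) (hDc : ∀ i, ContinuousOn (fun t => D t i) (Ici 0))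
    (hL : ∀ i, ∃ L : Measure ℝ, IsNonnegFirstKindResolvent (fun t => D t i) L ∧
      ∀ t : ℝ, 0 ≤ t → AntitoneOn (fun s : ℝ => L (Icc s (s + t))) (Ici 0))
    (hu : ∀ i, 0 ≤ u i) (hv : ∀ i, 0 < v i) (hF : ∀ᵐ t ∂volPos, ∀ i, 0 ≤ F t i)
    (hG : ∀ᵐ t ∂volPos, ∀ i j, i ≠ j → 0 ≤ G t i j) :
    ∀ᵐ t ∂volPos, ∀ i, 0 ≤ χ t i := by
  set f : ℝ → Fin d → ℝ := fun s => F s + (G s).mulVec (χ s) with hfdef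
  have hf : ForcingData f := hFd.add (h.forcingData_mulVec hχ.meas hχ.sq)
  have hDi : ∀ i, Measurable fun t => D t i := fun i =>
    (measurable_pi_apply i).comp h.kernel_meas
  have hDneg : ∀ i, ∀ t < 0, D t i = 0 := fun i t ht => by rw [h.kernel_neg t ht]; rfl
  -- A continuous version of `χ`, namely the right-hand side of its equation; `max t 0` keeps it
  -- continuous across `t = 0`, where `D` may jump.
  set y : ℝ → Fin d → ℝ := fun t i => D (max t 0) i * u i + v i + ∫ s, D (t - s) i * f s i
    with hydef
  have hyc : Continuous y := by
    refine continuous_pi fun i => ((Continuous.mul ?_ continuous_const).add continuous_const).add ?_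
    · exact (hDc i).comp_continuous (continuous_id.max continuous_const)
        fun t => le_max_right t 0
    · exact continuous_convolution_of_bounded (hDi i) (hDneg i) (fun t => hDC t i) (hDc i)
        ((measurable_pi_apply i).comp hf.meas) (fun t ht => by rw [hf.neg t ht]; rfl)
        (hf.integrableOn i)
  have hyχ : ∀ᵐ t ∂volPos, χ t = y t := by
    filter_upwards [hχ.equation, hχ.integrable, ae_restrict_mem measurableSet_Ici] with t h1 h2 h3
    funext i
    rw [h1]
    simp only [hydef, Pi.add_apply, Pi.mul_apply, max_eq_left (mem_Ici.1 h3)]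
    rw [eval_integral fun i => h2.eval i]
    rfl
  have hff : ∀ᵐ s, f s = F s + (G s).mulVec (y s) := by
    filter_upwards [(ae_restrict_iff' measurableSet_Ici).1 hyχ] with s hs
    rcases lt_or_ge s 0 with h0 | h0
    · simp [hfdef, h.mult_neg s h0]
    · simp only [hfdef, hs h0]
  have hpos := pos_of_continuous_solution (k := fun i t => D t i) hDi hDneg (fun i t => hDC t i)
    hD0 hL hu hv hF hG h.intervalIntegrable_diag hyc ?_ ?_
  · filter_upwards [hyχ, ae_restrict_mem measurableSet_Ici] with t h1 h2 i
    rw [h1]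
    exact (hpos t h2 i).le
  · intro i T
    refine ((hf.integrableOn i T).mono_set Ioc_subset_Icc_self).congr_fun_ae ?_
    filter_upwards [ae_restrict_of_ae hff] with s hs
    rw [hs]; rfl
  · intro t ht i
    simp only [hydef, max_eq_left ht]
    congr 1
    rw [intervalIntegral.integral_of_le ht]
    have e1 : ∫ s in Ioc 0 t, D (t - s) i * f s i = ∫ s, D (t - s) i * f s i := by
      refine setIntegral_eq_integral_of_ae_compl_eq_zero ?_
      have hne : ∀ᵐ s : ℝ, s ≠ 0 := by simp [ae_iff]
      filter_upwards [hne] with s hs0 hs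
      rcases lt_or_gt_of_ne hs0 with h0 | h0
      · rw [hf.neg s h0]; simp
      · have : t < s := by by_contra hh; exact hs ⟨h0, not_lt.1 hh⟩
        rw [h.kernel_neg _ (by linarith)]; simp
    rw [← e1]
    refine integral_congr_ae ?_
    filter_upwards [ae_restrict_of_ae hff] with s hs
    rw [hs]; rfl

end

/-! ### Approximation of the kernels by their shifts -/

theorem measurable_indicator_of_continuousOn {f : ℝ → ℝ} {s : Set ℝ} (hs : MeasurableSet s)
    (hf : ContinuousOn f s) : Measurable (s.indicator f) := by
  classical
  rw [← piecewise_eq_indicator]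
  exact hf.measurable_piecewise continuousOn_const hs

theorem IsNonnegFirstKindResolvent.congr {k k' : ℝ → ℝ} {L : Measure ℝ}
    (h : IsNonnegFirstKindResolvent k L) (hk : ∀ t, 0 ≤ t → k' t = k t) :
    IsNonnegFirstKindResolvent k' L where
  locallyFinite := h.locallyFinite
  support := h.support
  integrable t ht := (h.integrable t ht).congr_fun
    (fun s hs => (hk _ (sub_nonneg.2 hs.2)).symm) measurableSet_Icc
  conv_eq_one t ht := by
    rw [← h.conv_eq_one t ht]
    exact setIntegral_congr_fun measurableSet_Icc fun s hs => hk _ (sub_nonneg.2 hs.2)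

section

variable {d : ℕ}

/-- The scalar kernels `κ i`, extended by zero to `(-∞, 0]`. -/
noncomputable def zeroExtension (κ : Fin d → ℝ → ℝ) (t : ℝ) (i : Fin d) : ℝ :=
  (Ioi 0).indicator (κ i) t

/-- The shifted kernels `Δ_h κ i`, extended by zero to `(-∞, 0)`. -/
noncomputable def shiftExtension (h : ℝ) (κ : Fin d → ℝ → ℝ) (t : ℝ) (i : Fin d) : ℝ :=
  (Ici 0).indicator (kernelShift h (κ i)) t

/-- Nonnegative, non-increasing, continuous kernels on `(0, ∞)` that are locally square
integrable. -/
structure MonotoneKernels (κ : Fin d → ℝ → ℝ) : Prop where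
  nonneg : ∀ i, ∀ t > 0, 0 ≤ κ i t
  antitone : ∀ i, AntitoneOn (κ i) (Ioi 0)
  continuous : ∀ i, ContinuousOn (κ i) (Ioi 0)
  sq : ∀ i (T : ℝ), ∫⁻ t in Icc 0 T, ‖κ i t‖ₑ ^ 2 ≠ ⊤

namespace MonotoneKernels

variable {κ : Fin d → ℝ → ℝ} {h : ℝ}

theorem measurable_zeroExtension (hκ : MonotoneKernels κ) : Measurable (zeroExtension κ) :=
  measurable_pi_iff.2 fun i =>
    measurable_indicator_of_continuousOn measurableSet_Ioi (hκ.continuous i)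

theorem continuousOn_shift (hκ : MonotoneKernels κ) (hh : 0 < h) (i : Fin d) :
    ContinuousOn (kernelShift h (κ i)) (Ici 0) :=
  (hκ.continuous i).comp (by fun_prop) fun t ht => by
    simp only [mem_Ici, mem_Ioi] at ht ⊢; linarith

theorem measurable_shiftExtension (hκ : MonotoneKernels κ) (hh : 0 < h) :
    Measurable (shiftExtension h κ) :=
  measurable_pi_iff.2 fun i =>
    measurable_indicator_of_continuousOn measurableSet_Ici (hκ.continuousOn_shift hh i)

theorem shiftExtension_nonneg (hκ : MonotoneKernels κ) (hh : 0 < h) (t : ℝ) (i : Fin d) :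
    0 ≤ shiftExtension h κ t i :=
  indicator_nonneg (fun s hs => hκ.nonneg i _ (by simp only [mem_Ici] at hs; linarith)) t

/-- Monotonicity of the kernels. The point `t = 0` is excluded because there the zero extension
vanishes while the shift takes the value `κ i h`. -/
theorem shiftExtension_le (hκ : MonotoneKernels κ) (hh : 0 < h) {t : ℝ} (ht : t ≠ 0)
    (i : Fin d) : shiftExtension h κ t i ≤ zeroExtension κ t i := by
  rcases lt_or_gt_of_ne ht with h0 | h0
  · simp [shiftExtension, zeroExtension, h0.not_ge, h0.le]
  · simp only [shiftExtension, zeroExtension, indicator_of_mem (mem_Ici.2 h0.le),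
      indicator_of_mem (mem_Ioi.2 h0), kernelShift]
    exact hκ.antitone i h0 (by simp only [mem_Ioi]; linarith) (by linarith)

theorem enorm_shiftExtension_le (hκ : MonotoneKernels κ) (hh : 0 < h) {t : ℝ} (ht : t ≠ 0) :
    ‖shiftExtension h κ t‖ₑ ≤ ‖zeroExtension κ t‖ₑ := by
  refine enorm_pi_le fun i => le_trans ?_ (enorm_apply_le _ i)
  rw [enorm_le_iff_norm_le]
  have h1 := hκ.shiftExtension_nonneg hh t i
  have h2 := hκ.shiftExtension_le hh ht i
  rw [Real.norm_of_nonneg h1, Real.norm_of_nonneg (h1.trans h2)]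
  exact h2

theorem enorm_shiftExtension_sub_le (hκ : MonotoneKernels κ) (hh : 0 < h) {t : ℝ}
    (ht : t ≠ 0) : ‖shiftExtension h κ t - zeroExtension κ t‖ₑ ≤ ‖zeroExtension κ t‖ₑ := by
  refine enorm_pi_le fun i => le_trans ?_ (enorm_apply_le _ i)
  rw [enorm_le_iff_norm_le]
  have h1 := hκ.shiftExtension_nonneg hh t i
  have h2 := hκ.shiftExtension_le hh ht i
  rw [Pi.sub_apply, Real.norm_of_nonneg (h1.trans h2), Real.norm_eq_abs, abs_le]
  constructor <;> linarith

/-- A shifted non-increasing kernel is bounded by its value `κ i h` at the origin, even if `κ i` is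
singular at zero. -/
theorem abs_shiftExtension_le (hκ : MonotoneKernels κ) (hh : 0 < h) :
    ∃ C : ℝ, ∀ t i, |shiftExtension h κ t i| ≤ C := by
  refine ⟨∑ i, κ i h, fun t i => ?_⟩
  rw [abs_of_nonneg (hκ.shiftExtension_nonneg hh t i)]
  refine le_trans ?_ (Finset.single_le_sum (f := fun i => κ i h)
    (fun j _ => hκ.nonneg j h hh) (Finset.mem_univ i))
  refine indicator_apply_le' (fun ht => ?_) fun _ => hκ.nonneg i h hh
  rw [mem_Ici] at ht
  exact hκ.antitone i hh (show 0 < t + h by linarith) (by linarith)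

theorem zeroExtension_sq (hκ : MonotoneKernels κ) (T : ℝ) :
    ∫⁻ t in Icc 0 T, ‖zeroExtension κ t‖ₑ ^ 2 ≠ ⊤ := by
  have hm : ∀ i, Measurable fun t => zeroExtension κ t i := fun i =>
    (measurable_pi_apply i).comp hκ.measurable_zeroExtension
  refine ne_top_of_le_ne_top (lintegral_finset_sum_sq_ne_top Finset.univ
    (f := fun i t => ‖zeroExtension κ t i‖ₑ) (fun i _ => (hm i).enorm)
    (fun i _ => ne_top_of_le_ne_top (hκ.sq i T) ?_)) (lintegral_mono fun t => ?_)
  · refine lintegral_mono fun t => ?_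
    gcongr
    exact enorm_indicator_le_enorm_self _ _
  · gcongr
    exact enorm_pi_le fun i => Finset.single_le_sum (f := fun i => ‖zeroExtension κ t i‖ₑ)
      (fun _ _ => zero_le) (Finset.mem_univ i)

theorem volterraData (hκ : MonotoneKernels κ) {G : ℝ → Matrix (Fin d) (Fin d) ℝ}
    (hGm : ∀ i j, Measurable fun t => G t i j) (hGneg : ∀ t < 0, G t = 0)
    (hGsq : ∀ T : ℝ, ∫⁻ s in Icc 0 T, matrixEnorm (G s) ^ 2 ≠ ⊤) :
    VolterraData (zeroExtension κ) G where
  kernel_meas := hκ.measurable_zeroExtension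
  kernel_neg t ht := funext fun i => indicator_of_notMem (by simpa using ht.le) _
  kernel_sq := hκ.zeroExtension_sq
  mult_meas := hGm
  mult_neg := hGneg
  mult_sq := hGsq

theorem volterraData_shift (hκ : MonotoneKernels κ) (hh : 0 < h)
    {G : ℝ → Matrix (Fin d) (Fin d) ℝ} (hV : VolterraData (zeroExtension κ) G) :
    VolterraData (shiftExtension h κ) G where
  kernel_meas := hκ.measurable_shiftExtension hh
  kernel_neg t ht := funext fun i => indicator_of_notMem (by simpa using ht) _
  kernel_sq T := by
    refine ne_top_of_le_ne_top (hκ.zeroExtension_sq T) (lintegral_mono_ae ?_)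
    have hne : ∀ᵐ s ∂(volume.restrict (Icc (0 : ℝ) T)), s ≠ 0 :=
      ae_restrict_of_ae (by simp [ae_iff])
    filter_upwards [hne] with s hs
    gcongr
    exact hκ.enorm_shiftExtension_le hh hs
  mult_meas := hV.mult_meas
  mult_neg := hV.mult_neg
  mult_sq := hV.mult_sq

theorem tendsto_shiftExtension (hκ : MonotoneKernels κ) (T : ℝ) :
    Tendsto (fun n : ℕ => ∫⁻ t in Icc 0 T,
      ‖shiftExtension (1 / ((n : ℝ) + 1)) κ t - zeroExtension κ t‖ₑ ^ 2) atTop (𝓝 0) := by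
  have hn : ∀ n : ℕ, (0 : ℝ) < 1 / ((n : ℝ) + 1) := fun n => by positivity
  have hne : ∀ᵐ s ∂(volume.restrict (Icc (0 : ℝ) T)), s ≠ 0 :=
    ae_restrict_of_ae (by simp [ae_iff])
  have hlim := tendsto_lintegral_of_dominated_convergence (μ := volume.restrict (Icc (0 : ℝ) T))
    (F := fun (n : ℕ) t => ‖shiftExtension (1 / ((n : ℝ) + 1)) κ t - zeroExtension κ t‖ₑ ^ 2)
    (f := fun _ => 0) (fun t => ‖zeroExtension κ t‖ₑ ^ 2) (fun n => ?_) (fun n => ?_)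
    (hκ.zeroExtension_sq T) ?_
  · simpa using hlim
  · exact ((hκ.measurable_shiftExtension (hn n)).sub
      hκ.measurable_zeroExtension).enorm.pow_const 2
  · filter_upwards [hne] with s hs
    gcongr
    exact hκ.enorm_shiftExtension_sub_le (hn n) hs
  · filter_upwards [hne, ae_restrict_mem measurableSet_Icc] with t ht htm
    have ht0 : 0 < t := lt_of_le_of_ne htm.1 ht.symm
    have hpt : Tendsto (fun n : ℕ => shiftExtension (1 / ((n : ℝ) + 1)) κ t) atTop
        (𝓝 (zeroExtension κ t)) := by
      rw [tendsto_pi_nhds]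
      intro i
      simp only [shiftExtension, zeroExtension, indicator_of_mem (mem_Ici.2 ht0.le),
        indicator_of_mem (mem_Ioi.2 ht0), kernelShift]
      have hc : ContinuousAt (κ i) t := (hκ.continuous i).continuousAt (Ioi_mem_nhds ht0)
      have h1 : Tendsto (fun n : ℕ => t + 1 / ((n : ℝ) + 1)) atTop (𝓝 (t + 0)) :=
        tendsto_one_div_add_atTop_nhds_zero_nat.const_add t
      rw [add_zero] at h1
      exact hc.tendsto.comp h1
    have h2 := (hpt.sub_const (zeroExtension κ t)).enorm
    rw [sub_self, enorm_zero] at h2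
    simpa using ENNReal.Tendsto.pow (n := 2) h2

/-- Positivity of the solution, by approximation of the kernels with their shifts. -/
theorem nonneg_of_isExtendedSolution (hκ : MonotoneKernels κ)
    (hB : ∀ i, ∀ h ∈ Icc (0 : ℝ) 1, OrthantCondition (kernelShift h (κ i)))
    {G : ℝ → Matrix (Fin d) (Fin d) ℝ} (hV : VolterraData (zeroExtension κ) G)
    {F : ℝ → Fin d → ℝ} (hFd : ForcingData F) {u v : Fin d → ℝ} {χ : ℝ → Fin d → ℝ}
    (hχ : IsExtendedSolution (zeroExtension κ) G F u v χ)
    (hu : ∀ i, 0 ≤ u i) (hv : ∀ i, 0 ≤ v i) (hF : ∀ᵐ t ∂volPos, ∀ i, 0 ≤ F t i)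
    (hG : ∀ᵐ t ∂volPos, ∀ i j, i ≠ j → 0 ≤ G t i j) :
    ∀ᵐ t ∂volPos, ∀ i, 0 ≤ χ t i := by
  set η : ℕ → ℝ := fun n => 1 / ((n : ℝ) + 1) with hη
  have hη0 : ∀ n, 0 < η n := fun n => by positivity
  have hη1 : ∀ n, η n ≤ 1 := fun n => by
    rw [hη]
    simp only
    rw [div_le_one (by positivity)]
    linarith [Nat.cast_nonneg (α := ℝ) n]
  set V : ℕ → Fin d → ℝ := fun n i => v i + η n with hVdef
  have hVn := fun n => hκ.volterraData_shift (hη0 n) hV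
  choose X hX using fun n => (hVn n).exists_isExtendedSolution hFd u (V n)
  have hXpos : ∀ n, ∀ᵐ t ∂volPos, ∀ i, 0 ≤ X n t i := by
    intro n
    obtain ⟨C, hC⟩ := hκ.abs_shiftExtension_le (hη0 n)
    refine (hX n).nonneg_of_bounded (hVn n) hFd hC
      (fun i => hκ.shiftExtension_nonneg (hη0 n) 0 i) (fun i => ?_) (fun i => ?_) hu
      (fun i => by have := hv i; have := hη0 n; simp only [hVdef]; linarith) hF hG
    · refine (hκ.continuousOn_shift (hη0 n) i).congr fun t ht => ?_
      exact indicator_of_mem ht _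
    · obtain ⟨L, hL1, hL2⟩ := (hB i (η n) ⟨(hη0 n).le, hη1 n⟩).resolvent
      exact ⟨L, hL1.congr fun t ht => indicator_of_mem (mem_Ici.2 ht) _, hL2⟩
  refine ae_volPos_of_forall_Icc fun T => ae_all_iff.2 fun i => ?_
  obtain ⟨C, hC, hst⟩ := hV.exists_stability hFd hχ T
  -- Since `X n ≥ 0`, the negative part of `χ` is at most `|X n - χ|`, to which the stability
  -- estimate applies.
  have hbound : ∀ n, ∫⁻ t in Icc 0 T, ENNReal.ofReal (-χ t i) ^ 2 ≤
      C * ((∫⁻ t in Icc 0 T, ‖shiftExtension (η n) κ t - zeroExtension κ t‖ₑ ^ 2) +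
        ‖V n - v‖ₑ ^ 2) := by
    intro n
    refine le_trans (lintegral_mono_ae ?_) (hst _ _ _ (hVn n)
      (fun t ht => hκ.enorm_shiftExtension_le (hη0 n) ht) (hX n))
    filter_upwards [ae_Icc_of_ae_volPos (hXpos n) T] with t ht
    gcongr
    refine le_trans ?_ (enorm_apply_le _ i)
    rw [Pi.sub_apply, ← ofReal_norm]
    refine ENNReal.ofReal_le_ofReal (le_trans ?_ (le_abs_self _))
    linarith [ht i]
  have hVlim : Tendsto (fun n => ‖V n - v‖ₑ ^ 2) atTop (𝓝 0) := by
    have h1 : Tendsto (fun n => V n - v) atTop (𝓝 0) := by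
      rw [tendsto_pi_nhds]
      intro j
      simpa [hVdef, hη] using tendsto_one_div_add_atTop_nhds_zero_nat (𝕜 := ℝ)
    have h2 := h1.enorm
    rw [enorm_zero] at h2
    simpa using ENNReal.Tendsto.pow (n := 2) h2
  have hlim := ENNReal.Tendsto.const_mul (a := C)
    ((hκ.tendsto_shiftExtension T).add hVlim) (Or.inr hC)
  rw [add_zero, mul_zero] at hlim
  have hzero := le_antisymm (ge_of_tendsto' hlim hbound) zero_le
  have hm : Measurable fun t => χ t i := (measurable_pi_apply i).comp hχ.meas
  rw [lintegral_eq_zero_iff (by fun_prop)] at hzero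
  filter_upwards [hzero] with t ht
  simpa using ht

end MonotoneKernels

end

/-! ### Passage to measurable representatives and the theorem -/

theorem MemLpLoc.lintegral_sq_ne_top {E : Type*} [NormedAddCommGroup E] {f : ℝ → E}
    (hf : MemLpLoc 2 f) (T : ℝ) : ∫⁻ s in Icc 0 T, ‖f s‖ₑ ^ 2 ≠ ⊤ := by
  have h := (eLpNorm_lt_top_iff_lintegral_rpow_enorm_lt_top (by norm_num) (by norm_num)).1 (hf T).2
  simpa using h.ne

theorem memLpLoc_two_of_lintegral_sq {E : Type*} [NormedAddCommGroup E] {f : ℝ → E}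
    (hf : ∀ T : ℝ, AEStronglyMeasurable f (volume.restrict (Icc 0 T)))
    (h : ∀ T : ℝ, ∫⁻ s in Icc 0 T, ‖f s‖ₑ ^ 2 ≠ ⊤) : MemLpLoc 2 f := fun T => by
  refine ⟨hf T, (eLpNorm_lt_top_iff_lintegral_rpow_enorm_lt_top (by norm_num) (by norm_num)).2 ?_⟩
  simpa using (h T).lt_top

/-- A locally `L^p` function has a measurable modification that vanishes on `(-∞, 0)`. -/
theorem MemLpLoc.exists_measurable {E : Type*} [NormedAddCommGroup E] [MeasurableSpace E]
    [BorelSpace E] {p : ENNReal} {f : ℝ → E} (hf : MemLpLoc p f) :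
    ∃ m : ℝ → E, Measurable m ∧ (∀ t < 0, m t = 0) ∧ f =ᵐ[volPos] m := by
  have hsm : AEStronglyMeasurable f volPos := by
    rw [volPos, Ici_zero_eq_iUnion_Icc, aestronglyMeasurable_iUnion_iff]
    exact fun n => (hf n).1
  refine ⟨(Ici 0).indicator (hsm.mk f), hsm.stronglyMeasurable_mk.measurable.indicator
    measurableSet_Ici, fun t ht => indicator_of_notMem (by simpa using ht) _, ?_⟩
  filter_upwards [hsm.ae_eq_mk, ae_restrict_mem measurableSet_Ici] with t h1 h2
  rw [indicator_of_mem h2, h1]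

theorem setLIntegral_Icc_congr_of_ae_volPos {f g : ℝ → ENNReal} (h : f =ᵐ[volPos] g) (T : ℝ) :
    ∫⁻ s in Icc 0 T, f s = ∫⁻ s in Icc 0 T, g s :=
  lintegral_congr_ae (ae_Icc_of_ae_volPos h T)

section

variable {d : ℕ} {K : ℝ → Matrix (Fin d) (Fin d) ℝ}

theorem mulVec_eq_zeroExtension_mul (hdiag : ∀ t : ℝ, 0 < t → (K t).IsDiag) {t : ℝ} (ht : 0 < t)
    (x : Fin d → ℝ) : (K t).mulVec x = zeroExtension (fun i t => K t i i) t * x := by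
  funext i
  rw [Matrix.mulVec, dotProduct, Finset.sum_eq_single i]
  · simp [zeroExtension, indicator_of_mem (mem_Ioi.2 ht)]
  · intro j _ hj
    rw [hdiag t ht hj.symm, zero_mul]
  · simp

theorem ae_mulVec_eq_zeroExtension_mul (hdiag : ∀ t : ℝ, 0 < t → (K t).IsDiag)
    {f g : ℝ → Fin d → ℝ} (hfg : f =ᵐ[volPos] g) (t : ℝ) :
    (fun s => (K (t - s)).mulVec (f s)) =ᵐ[volume.restrict (Ioc 0 t)]
      fun s => zeroExtension (fun i t => K t i i) (t - s) * g s := by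
  have hne : ∀ᵐ s ∂(volume.restrict (Ioc 0 t)), s ≠ t := ae_restrict_of_ae (by simp [ae_iff])
  filter_upwards [hne, ae_restrict_mem measurableSet_Ioc,
    ae_restrict_of_ae_restrict_of_subset (fun s hs => hs.1.le) hfg] with s h1 h2 h3
  rw [h3, mulVec_eq_zeroExtension_mul hdiag (sub_pos.2 (lt_of_le_of_ne h2.2 h1))]

theorem zeroExtension_mul_eq_zero {κ : Fin d → ℝ → ℝ} {g : ℝ → Fin d → ℝ}
    (hg : ∀ s < 0, g s = 0) {s t : ℝ} (hs : s ∉ Icc 0 t) :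
    zeroExtension κ (t - s) * g s = 0 := by
  rcases lt_or_ge s 0 with h0 | h0
  · rw [hg s h0, mul_zero]
  · have h1 : t < s := by by_contra hh; exact hs ⟨h0, not_lt.1 hh⟩
    have : zeroExtension κ (t - s) = 0 :=
      funext fun i => indicator_of_notMem (by simpa using h1.le) _
    rw [this, zero_mul]

theorem intervalIntegrable_mulVec_iff (hdiag : ∀ t : ℝ, 0 < t → (K t).IsDiag)
    {f g : ℝ → Fin d → ℝ} (hfg : f =ᵐ[volPos] g) (hg : ∀ s < 0, g s = 0) {t : ℝ} (ht : 0 ≤ t) :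
    IntervalIntegrable (fun s => (K (t - s)).mulVec (f s)) volume 0 t ↔
      Integrable fun s => zeroExtension (fun i t => K t i i) (t - s) * g s := by
  rw [intervalIntegrable_iff_integrableOn_Ioc_of_le ht, IntegrableOn,
    integrable_congr (ae_mulVec_eq_zeroExtension_mul hdiag hfg t), ← IntegrableOn,
    ← integrableOn_Icc_iff_integrableOn_Ioc]
  refine integrableOn_iff_integrable_of_support_subset fun s hs => ?_
  by_contra hs'
  exact hs (zeroExtension_mul_eq_zero hg hs')

theorem intervalIntegral_mulVec_eq (hdiag : ∀ t : ℝ, 0 < t → (K t).IsDiag)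
    {f g : ℝ → Fin d → ℝ} (hfg : f =ᵐ[volPos] g) (hg : ∀ s < 0, g s = 0) {t : ℝ} (ht : 0 ≤ t) :
    ∫ s in (0 : ℝ)..t, (K (t - s)).mulVec (f s) =
      ∫ s, zeroExtension (fun i t => K t i i) (t - s) * g s := by
  rw [intervalIntegral.integral_of_le ht,
    integral_congr_ae (ae_mulVec_eq_zeroExtension_mul hdiag hfg t), ← integral_Icc_eq_integral_Ioc]
  exact setIntegral_eq_integral_of_forall_compl_eq_zero fun s hs => zeroExtension_mul_eq_zero hg hs

/-- Solutions of the Volterra equation correspond to extended solutions. -/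
theorem isLinearVolterraSolution_iff (hdiag : ∀ t : ℝ, 0 < t → (K t).IsDiag)
    {u v : Fin d → ℝ} {F F' χ χ' : ℝ → Fin d → ℝ} {G G' : ℝ → Matrix (Fin d) (Fin d) ℝ}
    (hF : F =ᵐ[volPos] F') (hG : G =ᵐ[volPos] G') (hχ : χ =ᵐ[volPos] χ')
    (hF' : ∀ t < 0, F' t = 0) (hG' : ∀ t < 0, G' t = 0) (hχ' : Measurable χ') :
    IsLinearVolterraSolution K u v F G χ ↔
      IsExtendedSolution (zeroExtension fun i t => K t i i) G' F' u v χ' := by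
  have hfg : (fun s => F s + (G s).mulVec (χ s)) =ᵐ[volPos]
      fun s => F' s + (G' s).mulVec (χ' s) := by
    filter_upwards [hF, hG, hχ] with s h1 h2 h3
    rw [h1, h2, h3]
  have hneg : ∀ s < 0, F' s + (G' s).mulVec (χ' s) = 0 := fun s hs => by
    simp [hF' s hs, hG' s hs]
  -- Time zero is discarded: `K 0` need not be diagonal, and the zero extension ignores its value.
  have hpos : ∀ᵐ t ∂volPos, 0 < t := by
    have hne : ∀ᵐ t ∂volPos, t ≠ 0 := ae_restrict_of_ae (by simp [ae_iff])
    filter_upwards [hne, ae_restrict_mem measurableSet_Ici] with t h1 h2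
    exact lt_of_le_of_ne h2 h1.symm
  have hsq : ∀ T : ℝ, ∫⁻ s in Icc 0 T, ‖χ s‖ₑ ^ 2 = ∫⁻ s in Icc 0 T, ‖χ' s‖ₑ ^ 2 :=
    setLIntegral_Icc_congr_of_ae_volPos (hχ.fun_comp fun x => ‖x‖ₑ ^ 2)
  constructor
  · intro h
    refine ⟨hχ', fun T => hsq T ▸ h.memL2.lintegral_sq_ne_top T, ?_, ?_⟩
    · filter_upwards [h.integrable, hpos] with t h1 h2
      exact (intervalIntegrable_mulVec_iff hdiag hfg hneg h2.le).1 h1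
    · filter_upwards [h.equation, hpos, hχ] with t h1 h2 h3
      rw [← h3, h1, mulVec_eq_zeroExtension_mul hdiag h2,
        intervalIntegral_mulVec_eq hdiag hfg hneg h2.le]
  · intro h
    refine ⟨memLpLoc_two_of_lintegral_sq (fun T => ?_) fun T => (hsq T).symm ▸ h.sq T, ?_, ?_⟩
    · exact hχ'.aestronglyMeasurable.congr
        (ae_Icc_of_ae_volPos (hχ.mono fun t ht => ht.symm) T)
    · filter_upwards [h.integrable, hpos] with t h1 h2
      exact (intervalIntegrable_mulVec_iff hdiag hfg hneg h2.le).2 h1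
    · filter_upwards [h.equation, hpos, hχ] with t h1 h2 h3
      rw [h3, h1, mulVec_eq_zeroExtension_mul hdiag h2,
        intervalIntegral_mulVec_eq hdiag hfg hneg h2.le]

end

theorem theoremT (d : ℕ) (K : ℝ → Matrix (Fin d) (Fin d) ℝ)
    (hK : MatrixMemLpLoc 2 K)
    (hdiag : ∀ t : ℝ, 0 < t → (K t).IsDiag)
    (hgamma : ∀ i, GammaCondition (fun t => K t i i))
    (horthant : ∀ i, ∀ h ∈ Set.Icc (0 : ℝ) 1,
      OrthantCondition (kernelShift h (fun t => K t i i)))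
    (u v : Fin d → ℝ) (F : ℝ → Fin d → ℝ) (G : ℝ → Matrix (Fin d) (Fin d) ℝ)
    (hF : MemLpLoc 1 F) (hG : MatrixMemLpLoc 2 G)
    (hu : ∀ i, 0 ≤ u i) (hv : ∀ i, 0 ≤ v i)
    (hFnonneg : ∀ᵐ t ∂volPos, ∀ i, 0 ≤ F t i)
    (hGnonneg : ∀ᵐ t ∂volPos, ∀ i j, i ≠ j → 0 ≤ G t i j) :
    ∃ χ : ℝ → Fin d → ℝ,
      IsLinearVolterraSolution K u v F G χ ∧
      (∀ χ' : ℝ → Fin d → ℝ, IsLinearVolterraSolution K u v F G χ' → χ' =ᵐ[volPos] χ) ∧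
      (∀ᵐ t ∂volPos, ∀ i, 0 ≤ χ t i) := by
  have hκ : MonotoneKernels fun i t => K t i i := by
    -- The shift by `h = 0` supplies monotonicity and continuity of the kernels themselves.
    have h0 : ∀ i, OrthantCondition fun t => K t i i := fun i => by
      have hshift : kernelShift 0 (fun t => K t i i) = fun t => K t i i :=
        funext fun t => by simp [kernelShift]
      exact hshift ▸ horthant i 0 ⟨le_rfl, zero_le_one⟩
    exact ⟨fun i => (h0 i).nonneg, fun i => (h0 i).antitone, fun i => (h0 i).continuous,
      fun i => (hK i i).lintegral_sq_ne_top⟩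
  obtain ⟨F', hF'm, hF'neg, hFF'⟩ := hF.exists_measurable
  choose g hgm hgneg hGg using fun i j => (hG i j).exists_measurable
  set G' : ℝ → Matrix (Fin d) (Fin d) ℝ := fun t => Matrix.of fun i j => g i j t with hG'def
  have hG'neg : ∀ t < 0, G' t = 0 := fun t ht => by
    ext i j
    exact hgneg i j t ht
  have hGG' : G =ᵐ[volPos] G' := by
    filter_upwards [ae_all_iff.2 fun i => ae_all_iff.2 fun j => hGg i j] with t ht
    ext i j
    exact ht i j
  have hgsq : ∀ i j (T : ℝ), ∫⁻ s in Icc 0 T, ‖g i j s‖ₑ ^ 2 ≠ ⊤ := fun i j T =>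
    ne_of_eq_of_ne
      (setLIntegral_Icc_congr_of_ae_volPos ((hGg i j).fun_comp fun x => ‖x‖ₑ ^ 2) T).symm
      ((hG i j).lintegral_sq_ne_top T)
  have hV : VolterraData (zeroExtension fun i t => K t i i) G' := by
    refine hκ.volterraData hgm hG'neg fun T => ?_
    exact lintegral_finset_sum_sq_ne_top _
      (fun i _ => Finset.measurable_sum _ fun j _ => (hgm i j).enorm)
      fun i _ => lintegral_finset_sum_sq_ne_top _ (fun j _ => (hgm i j).enorm)
        fun j _ => hgsq i j T
  have hFd : ForcingData F' := by
    exact ⟨hF'm, hF'neg, fun T => ne_of_eq_of_ne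
      (setLIntegral_Icc_congr_of_ae_volPos (hFF'.fun_comp fun x => ‖x‖ₑ) T).symm
      (memLp_one_iff_integrable.1 (hF T)).2.ne⟩
  obtain ⟨χ, hχ⟩ := hV.exists_isExtendedSolution hFd u v
  refine ⟨χ, (isLinearVolterraSolution_iff hdiag hFF' hGG' (ae_eq_refl χ) hF'neg hG'neg
    hχ.meas).2 hχ, fun χ' hχ' => ?_, ?_⟩
  · obtain ⟨m, hm, _, hmχ⟩ := hχ'.memL2.exists_measurable
    have hm' := (isLinearVolterraSolution_iff hdiag hFF' hGG' hmχ hF'neg hG'neg hm).1 hχ'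
    exact hmχ.trans (hV.ae_eq_of_isExtendedSolution hFd hχ hm')
  · refine hκ.nonneg_of_isExtendedSolution horthant hV hFd hχ hu hv ?_ ?_
    · filter_upwards [hFnonneg, hFF'] with t h1 h2
      rwa [← h2]
    · filter_upwards [hGnonneg, hGG'] with t h1 h2
      rwa [← h2]
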